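/- Let $k$ be a perfect field of characteristic different from $3$, with algebraic closure $\overline{k}$, and let $K = k(x)$ be the rational function field over $k$. A cubic extension of $K$ is a separable field extension $L/K$ of degree $3$ that is geometric, i.e. not of the form $K\ell$ with $\ell/k$ an extension of degree $3$. It is called purely cubic if it has a generator whose minimal polynomial over $K$ is of the form $X^3 - \beta$ with $\beta \in K$. A place $\mathfrak p$ of $K$ is fully ramified in $L$ if there is a place of $L$ above $\mathfrak p$ with ramification index $3$. Finite places of $K$ correspond to monic irreducible polynomials in $k[x]$; the remaining place is denoted $\infty$. Two cubic extensions $L_1, L_2$ of $K$ are isomorphic over $\overline{k}$ if $L_1\overline{k}$ and $L_2\overline{k}$ are isomorphic as extensions of $K\overline{k}$. Let $T$ be a finite set of places of $K$, and let $t$ be its cardinality. (1) Suppose that $\infty \notin T$. Put $n = t$, and let $P_1, \dots, P_n$ be the monic irreducible polynomials corresponding to the places of $T$, indexed such that for some $0 \le s \le r \le n$ $$\deg(P_i) \equiv \begin{cases} 0 \pmod 3 & \text{for } 1 \le i \le s,\\ -1 \pmod 3 & \text{for } s+1 \le i \le r,\\ 1 \pmod 3 & \text{for } r+1 \le i \le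 n.\end{cases} \qquad (*)$$ Then any purely cubic extension $L/K$ for which $T$ is exactly the set of fully ramified places admits a generator $y$ satisfying $$y^3 = u \, P_1^{\epsilon_1} \cdots P_s^{\epsilon_s} \, \frac{P_{r+1}^{\epsilon_{r+1}} \cdots P_n^{\epsilon_n}}{P_{s+1}^{\epsilon_{s+1}} \cdots P_r^{\epsilon_r}}, \qquad (**)$$ where $u \in k^*$, where $\epsilon_i \in \{\pm 1\}$ for all $1 \le i \le n$, where $\epsilon_1 = 1$ (if $n \geq 1$), and where $\sum_{i=s+1}^{n} \epsilon_i \equiv 0 \pmod 3$. (2) Suppose that $\infty \in T$. Put $n = t-1$, and let $P_1, \dots, P_n$ be the monic irreducible polynomials corresponding to the finite places in $T$, indexed as in $(*)$. Then any purely cubic extension $L/K$ for which $T$ is exactly the set of fully ramified places admits a generator $y$ satisfying $(**)$, where $u \in k^*$, where $\epsilon_i \in \{\pm 1\}$ for all $1 \le i \le n$, where $\epsilon_1 = 1$ (if $n \ge 1$), and where $\sum_{i=s+1}^{n} \epsilon_i \not\equiv 0 \pmod 3$. In both cases, if $T \ne \emptyset$, then the number of purely cubic extensions $L/K$ for which $T$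 is exactly the set of fully ramified places, counted up to isomorphism over $\overline{k}$, is finite and equal to $$\tfrac13 \cdot 2^s \left( 2^{t-s-1} - (-1)^{t-s-1} \right).$$ -/

import Mathlib

open scoped TensorProduct Polynomial IntermediateField

universe u v

noncomputable section

namespace PurelyCubic

/-! ### Places and ramification -/

/-- A place of an extension field `F` of `k`, given by its valuation ring: a valuation ring of `F`
that contains `k` and is different from `F`. -/
def Place (k F : Type*) [Field k] [Field F] [Algebra k F] : Type _ :=
  {O : ValuationSubring F // (∀ c : k, algebraMap k F c ∈ O) ∧ O ≠ ⊤}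

/-- The nonzero prime ideal `(P)` of `k[x]` generated by an irreducible polynomial `P`. -/
def primeIdeal {k : Type*} [Field k] (P : k[X]) (hP : Irreducible P) :
    IsDedekindDomain.HeightOneSpectrum k[X] where
  asIdeal := Ideal.span {P}
  isPrime := (Ideal.span_singleton_prime hP.ne_zero).mpr hP.prime
  ne_bot := by simpa using hP.ne_zero

/-- The place of `k(x)` given by an irreducible polynomial `P`; its valuation ring is the
localization of `k[x]` at `(P)`. -/
def finitePlace {k : Type*} [Field k] (P : k[X]) (hP : Irreducible P) : Place k (RatFunc k) :=
  ⟨((primeIdeal P hP).valuation (RatFunc k)).valuationSubring,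
    by
      intro c
      rw [Valuation.mem_valuationSubring_iff,
        IsScalarTower.algebraMap_apply k k[X] (RatFunc k)]
      exact IsDedekindDomain.HeightOneSpectrum.valuation_le_one _ _,
    by
      intro h
      have hm : ((algebraMap k[X] (RatFunc k) P)⁻¹ : RatFunc k) ∈
          ((primeIdeal P hP).valuation
            (RatFunc k)).valuationSubring := by
        rw [h]; trivial
      rw [Valuation.mem_valuationSubring_iff, map_inv₀] at hm
      have h1 : (primeIdeal P hP).valuation (RatFunc k)
          (algebraMap k[X] (RatFunc k) P) < 1 := by
        rw [IsDedekindDomain.HeightOneSpectrum.valuation_lt_one_iff_mem]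
        exact Ideal.mem_span_singleton_self P
      have h0 : (primeIdeal P hP).valuation (RatFunc k)
          (algebraMap k[X] (RatFunc k) P) ≠ 0 := by
        rw [Valuation.ne_zero_iff]
        simpa using hP.ne_zero
      have h2 := (one_lt_inv₀ (zero_lt_iff.mpr h0)).mpr h1
      exact absurd hm (not_le.mpr h2)⟩

open Classical in
/-- The place `∞` of `k(x)`; its valuation ring consists of the `f / g` with `deg f ≤ deg g`. -/
def inftyPlace (k : Type*) [Field k] : Place k (RatFunc k) :=
  ⟨(RatFunc.inftyValuation k).valuationSubring,
    by
      intro c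
      rw [Valuation.mem_valuationSubring_iff]
      by_cases hc : c = 0
      · simp [hc]
      · rw [RatFunc.algebraMap_eq_C, RatFunc.inftyValuation.C _ hc],
    by
      rw [Ne, Valuation.valuationSubring_eq_top_iff, not_not]
      infer_instance⟩

/-- The ramification index `e(O' | O) = (Γ_L : Γ_K)` of a valuation ring `O'` of `L` over its
restriction `O` to `K`, where `Γ_L = Lˣ / O'ˣ` and `Γ_K` is the image of `Kˣ` in it. -/
def ramificationIndex (K : Type*) {L : Type*} [Field K] [Field L] [Algebra K L]
    (O' : ValuationSubring L) : ℕ :=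
  (O'.unitGroup ⊔ (Units.map (algebraMap K L : K →* L)).range).index

/-- The set of places of `K` that are fully ramified in `L`: those that have a place of `L` above
them with ramification index `[L : K]`. -/
def fullyRamifiedPlaces (k K L : Type*) [Field k] [Field K] [Field L] [Algebra k K]
    [Algebra K L] : Set (Place k K) :=
  {p | ∃ O' : ValuationSubring L, O'.comap (algebraMap K L) = p.1 ∧
    ramificationIndex K O' = Module.finrank K L}

/-! ### Cubic extensions -/

/-- `L / K` is a cubic extension of the function field `K` over `k`: separable, of degree three, and
geometric, i.e. not of the form `K ℓ` with `ℓ / k` of degree three. -/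
structure IsCubic (k K L : Type*) [Field k] [Field K] [Field L] [Algebra k K] [Algebra k L]
    [Algebra K L] [IsScalarTower k K L] : Prop where
  separable : Algebra.IsSeparable K L
  degree : Module.finrank K L = 3
  geometric : ¬ ∃ ℓ : IntermediateField k L, Module.finrank k ℓ = 3 ∧
    IntermediateField.adjoin K (ℓ : Set L) = ⊤

/-- `L / K` is purely cubic: it is cubic and has a generator with minimal polynomial `X ^ 3 - β`. -/
def IsPurelyCubic (k K L : Type*) [Field k] [Field K] [Field L] [Algebra k K] [Algebra k L]
    [Algebra K L] [IsScalarTower k K L] : Prop :=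
  IsCubic k K L ∧ ∃ (y : L) (β : K), K⟮y⟯ = ⊤ ∧
    minpoly K y = Polynomial.X ^ 3 - Polynomial.C β

/-- The purely cubic extensions of `k(x)` that are fully ramified precisely over `T`. -/
structure Cover (k : Type u) [Field k] (T : Set (Place k (RatFunc k))) : Type (u + 1) where
  carrier : Type u
  [field : Field carrier]
  [algebraBase : Algebra k carrier]
  [algebra : Algebra (RatFunc k) carrier]
  [tower : IsScalarTower k (RatFunc k) carrier]
  purelyCubic : IsPurelyCubic k (RatFunc k) carrier
  ramified : fullyRamifiedPlaces k (RatFunc k) carrier = T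

attribute [instance] Cover.field Cover.algebraBase Cover.algebra Cover.tower

/-- `L₁` and `L₂` become isomorphic over the algebraic closure `k̄` of `k`, i.e. `L₁ k̄` and `L₂ k̄`
are isomorphic as extensions of `K k̄`. Here `F k̄` is `k̄ ⊗ F` (for a geometric cubic extension of
`k(x)` with `k` perfect this is a field, the compositum), so an isomorphism over `K k̄` is one of
`k̄`-algebras that is compatible with the maps from `K`. -/
def GeomIsomorphic (k K L₁ L₂ : Type*) [Field k] [Field K] [Field L₁] [Field L₂] [Algebra k L₁]
    [Algebra k L₂] [Algebra K L₁] [Algebra K L₂] : Prop :=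
  ∃ φ : (AlgebraicClosure k ⊗[k] L₁) ≃ₐ[AlgebraicClosure k] (AlgebraicClosure k ⊗[k] L₂),
    ∀ f : K, φ (1 ⊗ₜ algebraMap K L₁ f) = 1 ⊗ₜ algebraMap K L₂ f

/-- Isomorphism over `k̄` as an equivalence relation on covers. -/
def geomSetoid (k : Type u) [Field k] (T : Set (Place k (RatFunc k))) : Setoid (Cover k T) where
  r A B := GeomIsomorphic k (RatFunc k) A.carrier B.carrier
  iseqv :=
    { refl := fun _ => ⟨AlgEquiv.refl, fun _ => rfl⟩
      symm := by
        rintro A B ⟨φ, hφ⟩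
        exact ⟨φ.symm, fun f => by rw [← hφ f, AlgEquiv.symm_apply_apply]⟩
      trans := by
        rintro A B C ⟨φ, hφ⟩ ⟨ψ, hψ⟩
        exact ⟨φ.trans ψ, fun f => by rw [AlgEquiv.trans_apply, hφ, hψ]⟩ }

/-- The set of `k̄`-isomorphism classes of purely cubic extensions of `k(x)` that are fully ramified
precisely over `T`. -/
abbrev CoverClass (k : Type u) [Field k] (T : Set (Place k (RatFunc k))) : Type (u + 1) :=
  Quotient (geomSetoid k T)

/-! ### The explicit equations -/

/-- The finite places in `S` correspond to the monic irreducible polynomials `P 1, …, P n`, indexed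
such that `deg (P i)` is `0`, `-1`, `1` modulo `3` for `1 ≤ i ≤ s`, `s + 1 ≤ i ≤ r`,
`r + 1 ≤ i ≤ n` respectively. (Values of `P` outside `1, …, n` are irrelevant.) -/
structure IsIndexing {k : Type*} [Field k] (P : ℕ → {p : k[X] // p.Monic ∧ Irreducible p})
    (s r n : ℕ) (S : Set (Place k (RatFunc k))) : Prop where
  le_r : s ≤ r
  le_n : r ≤ n
  bij : Set.BijOn (fun i => finitePlace (P i).1 (P i).2.2) (Set.Icc 1 n) S
  deg_zero : ∀ i ∈ Finset.Icc 1 s, ((P i).1.natDegree : ℤ) ≡ 0 [ZMOD 3]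
  deg_neg_one : ∀ i ∈ Finset.Icc (s + 1) r, ((P i).1.natDegree : ℤ) ≡ -1 [ZMOD 3]
  deg_one : ∀ i ∈ Finset.Icc (r + 1) n, ((P i).1.natDegree : ℤ) ≡ 1 [ZMOD 3]

/-- `u P₁^ε₁ ⋯ Pₛ^εₛ · (P_{r+1}^ε_{r+1} ⋯ Pₙ^εₙ) / (P_{s+1}^ε_{s+1} ⋯ P_r^ε_r)` in `k(x)`. -/
def radicand {k : Type*} [Field k] (P : ℕ → {p : k[X] // p.Monic ∧ Irreducible p})
    (s r n : ℕ) (u : k) (ε : ℕ → ℤ) : RatFunc k :=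
  RatFunc.C u * (∏ i ∈ Finset.Icc 1 s, algebraMap k[X] (RatFunc k) (P i).1 ^ ε i) *
    ((∏ i ∈ Finset.Icc (r + 1) n, algebraMap k[X] (RatFunc k) (P i).1 ^ ε i) /
      ∏ i ∈ Finset.Icc (s + 1) r, algebraMap k[X] (RatFunc k) (P i).1 ^ ε i)

end PurelyCubic

end

/-!
# Purely cubic extensions of `k(x)` with prescribed full ramification

Let `L = K(y)` be cubic over `K = k(x)` with `y ^ 3 = β`. The fully ramified places are those at
which the order of `β` is not divisible by three (`mem_fullyRamifiedPlaces_iff`). If the order is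
prime to three, the values of `1`, `y`, `y ^ 2` lie in distinct classes modulo the values of `K`,
which forces ramification index three. If it is divisible by three, `y` can be scaled to a unit `θ`,
which is a root of a polynomial `X ^ 3 - γ` that is separable modulo the place. Such a place is
unramified (`unitGroup_sup_range_eq_top`): either the residue of `θ` is new, and a further value in
`L` would give four elements independent over `K`; or Newton approximation shows that `θ` is a limit
of elements of `K`, so that `L` has no other values than `K`. The same theorem shows that constant
extensions are unramified, hence that a cubic extension with a fully ramified place is geometric.

As `k[x]` is factorial, a rational function whose orders at all finite places are divisible by three
is a constant times a cube. So `β` may be replaced by `u ∏ P i ^ (± 1)`, the product being over the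
finite places in `T`, and `y⁻¹` allows one to normalize the first sign
(`IsIndexing.exists_generator`). The degree of this radicand modulo three is the sum of the signs
`ε i` for `i > s`, which decides whether `∞` is fully ramified.

Over `k̄` the constant `u` becomes a cube, so covers with the same signs become isomorphic
(`geomIsomorphic_of_pow_three`). Conversely, an isomorphism over `k̄` embeds both covers in one
algebraic closure of `k̄(x)`, in which the radical of one is a polynomial in the radical of the
other; a direct computation with cubes then shows that the radicands agree up to cubes and inversion
(`cube_classes_of_mem_adjoin`). As `k` is perfect, the `P i` have simple roots in `k̄`, and
comparing orders at these roots recovers the signs (`IsIndexing.eq_of_geomIsomorphic`). Every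
admissible choice of signs occurs (`IsIndexing.exists_cover`), so the covers are counted by the
normalized sign vectors with the right sum modulo three, which a recursion evaluates
(`three_mul_card_signs`).
-/

noncomputable section

namespace PurelyCubic

/-! ### Unramified extensions of valuation rings -/

/-- Newton approximation: a simple root `θ` of `g` that is congruent to an element of `R` is
approximated by elements of `R` to arbitrary order. -/
lemma exists_pow_dvd_sub_of_simple_root {R S : Type*} [CommRing R] [CommRing S] [IsLocalRing S]
    (j : R →+* S) [IsLocalHom j] {π : R} (hπ : ∀ a : R, ¬ IsUnit a → π ∣ a)
    (hπu : ¬ IsUnit (j π)) (g : R[X]) {θ : S} (hθ : g.eval₂ j θ = 0)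
    (hθ' : IsUnit (g.derivative.eval₂ j θ)) (h : ∃ a : R, ¬ IsUnit (θ - j a)) (n : ℕ) :
    ∃ a : R, j π ^ (n + 1) ∣ θ - j a := by
  have expand : ∀ a : R, ∃ c : S, j (g.eval a) + (θ - j a) * (j (g.derivative.eval a)
      + c * (θ - j a)) = 0 := by
    intro a
    obtain ⟨c, hc⟩ := Polynomial.binomExpansion (g.map j) (j a) (θ - j a)
    refine ⟨c, ?_⟩
    rw [add_sub_cancel, Polynomial.eval_map, hθ, Polynomial.derivative_map,
      Polynomial.eval_map_apply, Polynomial.eval_map_apply] at hc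
    rw [hc]; ring
  have unit : ∀ a : R, ¬ IsUnit (θ - j a) → IsUnit (j (g.derivative.eval a)) := by
    intro a ha
    have h1 : (θ - j a) ∣ g.derivative.eval₂ j θ - j (g.derivative.eval a) := by
      rw [← Polynomial.eval_map, ← Polynomial.eval_map_apply]
      exact Polynomial.sub_dvd_eval_sub _ _ _
    have h2 : ¬ IsUnit (g.derivative.eval₂ j θ - j (g.derivative.eval a)) :=
      fun hu => ha (isUnit_of_dvd_unit h1 hu)
    by_contra h3
    have := IsLocalRing.nonunits_add h2 h3
    rw [sub_add_cancel] at this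
    exact this hθ'
  induction n with
  | zero =>
    obtain ⟨a, ha⟩ := h
    refine ⟨a, ?_⟩
    obtain ⟨c, hc⟩ := expand a
    have hu : IsUnit (j (g.derivative.eval a) + c * (θ - j a)) := by
      by_contra h3
      have h4 : ¬ IsUnit (-(c * (θ - j a))) := by
        rw [IsUnit.neg_iff]
        exact fun hu => ha (isUnit_of_mul_isUnit_right hu)
      have := IsLocalRing.nonunits_add h3 h4
      rw [add_neg_cancel_right] at this
      exact this (unit a ha)
    have hg : ¬ IsUnit (g.eval a) := by
      intro h5
      have h6 : IsUnit ((θ - j a) * (j (g.derivative.eval a) + c * (θ - j a))) := by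
        rw [eq_neg_of_add_eq_zero_right hc, IsUnit.neg_iff]
        exact h5.map j
      exact ha (isUnit_of_mul_isUnit_left h6)
    have h7 : j π ∣ j (g.eval a) := map_dvd j (hπ _ hg)
    rw [zero_add, pow_one, ← hu.dvd_mul_right, eq_neg_of_add_eq_zero_right hc]
    exact (dvd_neg).mpr h7
  | succ n ih =>
    obtain ⟨a, ha⟩ := ih
    have ha' : ¬ IsUnit (θ - j a) := by
      intro hu
      exact hπu (isUnit_of_dvd_unit ((dvd_pow_self _ n.succ_ne_zero).trans ha) hu)
    obtain ⟨c, hc⟩ := expand a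
    obtain ⟨d, hd⟩ := (isUnit_of_map_unit j _ (unit a ha')).exists_right_inv
    have hd' : j (g.derivative.eval a) * j d = 1 := by rw [← map_mul, hd, map_one]
    refine ⟨a - g.eval a * d, ?_⟩
    have key : θ - j (a - g.eval a * d) = -(j d * c) * (θ - j a) ^ 2 := by
      rw [map_sub, map_mul]
      linear_combination (j d) * hc - (θ - j a) * hd'
    rw [key]
    refine Dvd.dvd.mul_left ?_ _
    calc j π ^ (n + 1 + 1) ∣ j π ^ ((n + 1) * 2) := pow_dvd_pow _ (by omega)
      _ ∣ _ := by rw [pow_mul]; exact pow_dvd_pow_of_dvd ha 2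

section Extension

variable {K L : Type*} [Field K] [Field L] [Algebra K L]
  {v : Valuation K (WithZero (Multiplicative ℤ))} {O' : ValuationSubring L}

lemma exists_aeval_eq_of_adjoin_eq_top [Algebra.IsAlgebraic K L] {y : L} (hgen : K⟮y⟯ = ⊤) (z : L) :
    ∃ q : K[X], Polynomial.aeval y q = z := by
  have hz : z ∈ K⟮y⟯ := by rw [hgen]; trivial
  rw [← IntermediateField.mem_toSubalgebra,
    IntermediateField.adjoin_simple_toSubalgebra_of_isAlgebraic
      (Algebra.IsAlgebraic.isAlgebraic y)] at hz
  rwa [Algebra.adjoin_singleton_eq_range_aeval] at hz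

lemma isEquiv_comap_of_comap_eq (h : O'.comap (algebraMap K L) = v.valuationSubring) :
    (O'.valuation.comap (algebraMap K L)).IsEquiv v := by
  rw [Valuation.isEquiv_iff_val_le_one]
  intro x
  rw [Valuation.comap_apply, ValuationSubring.valuation_le_one_iff, ← ValuationSubring.mem_comap, h,
    Valuation.mem_valuationSubring_iff]

lemma mem_unitGroup_sup_range_iff {x : Lˣ} :
    x ∈ O'.unitGroup ⊔ (Units.map (algebraMap K L : K →* L)).range ↔
      ∃ f : K, O'.valuation x = O'.valuation (algebraMap K L f) := by
  rw [Subgroup.mem_sup]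
  constructor
  · rintro ⟨y, hy, z, ⟨f, rfl⟩, rfl⟩
    refine ⟨f, ?_⟩
    rw [ValuationSubring.mem_unitGroup_iff] at hy
    simp [hy]
  · rintro ⟨f, hf⟩
    have hf0 : f ≠ 0 := by
      rintro rfl
      simp at hf
    refine ⟨x * (Units.map (algebraMap K L : K →* L) (Units.mk0 f hf0))⁻¹, ?_,
      _, ⟨Units.mk0 f hf0, rfl⟩, by simp⟩
    rw [ValuationSubring.mem_unitGroup_iff]
    have : O'.valuation (algebraMap K L f) ≠ 0 := by simpa using hf0
    simp [hf, this]

/-- If the residue of `θ` is not in the residue field of `K`, then `1` and `θ` have independent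
residues, so `a + b θ` has the larger of the values of `a` and `b`. -/
lemma exists_valuation_add_mul_eq (h : O'.comap (algebraMap K L) = v.valuationSubring)
    {θ : L} (hθ : O'.valuation θ ≤ 1)
    (hres : ∀ a : K, v a ≤ 1 → O'.valuation (θ - algebraMap K L a) = 1)
    (a b : K) (hab : ¬ (a = 0 ∧ b = 0)) :
    ∃ f : K, f ≠ 0 ∧
      O'.valuation (algebraMap K L a + algebraMap K L b * θ) = O'.valuation (algebraMap K L f) := by
  have heq := isEquiv_comap_of_comap_eq h
  rcases lt_or_ge (v b) (v a) with hlt | hle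
  · refine ⟨a, fun h0 => by simp [h0] at hlt, ?_⟩
    apply Valuation.map_add_eq_of_lt_left
    rw [map_mul]
    calc _ ≤ O'.valuation (algebraMap K L b) * 1 := by gcongr
      _ < _ := by rw [mul_one]; exact heq.lt_iff_lt.mpr hlt
  · have hb : b ≠ 0 := by
      rintro rfl
      apply hab
      simpa using hle
    refine ⟨b, hb, ?_⟩
    have h1 := hres (-(a / b)) (by
      rw [Valuation.map_neg, map_div₀]
      exact div_le_one_of_le₀ hle zero_le)
    have hb' : algebraMap K L b ≠ 0 := by simpa using hb
    have : algebraMap K L a + algebraMap K L b * θ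
        = algebraMap K L b * (θ - algebraMap K L (-(a / b))) := by
      rw [map_neg, map_div₀]; field_simp; ring
    rw [this, map_mul, h1, mul_one]

/-- If the residue of `θ` does not lie in the residue field of `K`, the residue degree is at least
two; in degree three this leaves no room for values of `L` that are not values of `K`. -/
lemma exists_valuation_eq_of_residue_notMem (h : O'.comap (algebraMap K L) = v.valuationSubring)
    (hdeg : Module.finrank K L = 3) {θ : L} (hθ : O'.valuation θ ≤ 1)
    (hres : ∀ a : K, v a ≤ 1 → O'.valuation (θ - algebraMap K L a) = 1) {x : L} (hx : x ≠ 0) :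
    ∃ f : K, O'.valuation x = O'.valuation (algebraMap K L f) := by
  by_contra hcon
  push Not at hcon
  have := FiniteDimensional.of_finrank_eq_succ hdeg
  have hli : LinearIndependent K ![1, θ, x, x * θ] := by
    rw [Fintype.linearIndependent_iff]
    intro c hc
    simp only [Fin.sum_univ_four, Matrix.cons_val] at hc
    have hc' : (algebraMap K L (c 0) + algebraMap K L (c 1) * θ)
        + x * (algebraMap K L (c 2) + algebraMap K L (c 3) * θ) = 0 := by
      simp only [Algebra.smul_def] at hc
      linear_combination hc
    have h23 : c 2 = 0 ∧ c 3 = 0 := by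
      by_contra h23
      obtain ⟨f, hf0, hf⟩ := exists_valuation_add_mul_eq h hθ hres _ _ h23
      have hf' : O'.valuation (algebraMap K L f) ≠ 0 := by simpa using hf0
      by_cases h01 : c 0 = 0 ∧ c 1 = 0
      · rw [h01.1, h01.2, map_zero, zero_mul, add_zero, zero_add] at hc'
        have := congrArg O'.valuation hc'
        rw [map_mul, hf, map_zero] at this
        exact mul_ne_zero (by simpa using hx) hf' this
      · obtain ⟨f', hf0', hf''⟩ := exists_valuation_add_mul_eq h hθ hres _ _ h01
        apply hcon (f' / f)
        have := congrArg O'.valuation (eq_neg_of_add_eq_zero_left hc')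
        rw [Valuation.map_neg, map_mul, hf, hf''] at this
        rw [map_div₀, map_div₀, this, mul_div_cancel_right₀ _ hf']
    have h01 : c 0 = 0 ∧ c 1 = 0 := by
      by_contra h01
      obtain ⟨f, hf0, hf⟩ := exists_valuation_add_mul_eq h hθ hres _ _ h01
      rw [h23.1, h23.2, map_zero, zero_mul, add_zero, mul_zero, add_zero] at hc'
      rw [hc', map_zero] at hf
      exact hf0 (by simpa using hf.symm)
    intro i
    fin_cases i
    exacts [h01.1, h01.2, h23.1, h23.2]
  have := hli.fintype_card_le_finrank
  simp [hdeg] at this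

/-- A nonzero multiple of a polynomial over `K` takes an integral value at the integral element `θ`,
and its values at `θ` and at an integral `a` in `K` are at least as close as `θ` and `a`. -/
lemma exists_mul_aeval_bounded (h : O'.comap (algebraMap K L) = v.valuationSubring)
    {θ : L} (hθ : O'.valuation θ ≤ 1) (q : K[X]) :
    ∃ e : K, e ≠ 0 ∧ O'.valuation (algebraMap K L e * Polynomial.aeval θ q) ≤ 1 ∧
      ∀ a : K, v a ≤ 1 →
        O'.valuation (algebraMap K L e * (Polynomial.aeval θ q - algebraMap K L (q.eval a)))
          ≤ O'.valuation (θ - algebraMap K L a) := by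
  have heq := isEquiv_comap_of_comap_eq h
  induction q using Polynomial.induction_on' with
  | add p q hp hq =>
    obtain ⟨e₁, h₁, b₁, c₁⟩ := hp
    obtain ⟨e₂, h₂, b₂, c₂⟩ := hq
    wlog hle : v e₁ ≤ v e₂ generalizing p q e₁ e₂
    · have := this q p e₂ h₂ b₂ c₂ e₁ h₁ b₁ c₁ (le_of_not_ge hle)
      rwa [add_comm p q]
    have hle' : O'.valuation (algebraMap K L e₁) ≤ O'.valuation (algebraMap K L e₂) :=
      heq.le_iff_le.mpr hle
    refine ⟨e₁, h₁, ?_, fun a ha => ?_⟩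
    · rw [map_add, mul_add]
      refine (Valuation.map_add _ _ _).trans (max_le b₁ (le_trans ?_ b₂))
      rw [map_mul, map_mul]
      gcongr
    · rw [map_add, Polynomial.eval_add, map_add, add_sub_add_comm, mul_add]
      refine (Valuation.map_add _ _ _).trans (max_le (c₁ a ha) (le_trans ?_ (c₂ a ha)))
      rw [map_mul, map_mul]
      gcongr
  | monomial n c =>
    rcases eq_or_ne c 0 with rfl | hc
    · exact ⟨1, one_ne_zero, by simp, by simp⟩
    have hc' : algebraMap K L c ≠ 0 := by simpa using hc
    refine ⟨c⁻¹, inv_ne_zero hc, ?_, fun a ha => ?_⟩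
    · rw [Polynomial.aeval_monomial, map_inv₀, inv_mul_cancel_left₀ hc', map_pow]
      exact pow_le_one₀ zero_le hθ
    · have ha' : O'.valuation (algebraMap K L a) ≤ 1 := heq.le_one_iff_le_one.mpr ha
      rw [Polynomial.aeval_monomial, Polynomial.eval_monomial, map_mul (algebraMap K L), ← mul_sub,
        map_inv₀, inv_mul_cancel_left₀ hc', map_pow]
      induction n with
      | zero => simp
      | succ n ih =>
        have : θ ^ (n + 1) - algebraMap K L a ^ (n + 1) =
            θ * (θ ^ n - algebraMap K L a ^ n) + (θ - algebraMap K L a) * algebraMap K L a ^ n := by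
          ring
        rw [this]
        refine (Valuation.map_add _ _ _).trans (max_le ?_ ?_)
        · rw [map_mul]
          exact mul_le_of_le_one_of_le hθ ih
        · rw [map_mul, map_pow]
          exact mul_le_of_le_of_le_one le_rfl (pow_le_one₀ zero_le ha')

/-- If `L = K(θ)` and `θ` is arbitrarily well approximated by elements of `K`, then every value of
`L` is a value of `K`. -/
lemma exists_valuation_eq_of_approx (h : O'.comap (algebraMap K L) = v.valuationSubring)
    [FiniteDimensional K L] {θ : L} (hgen : K⟮θ⟯ = ⊤) (hθ : O'.valuation θ ≤ 1)
    {π : K} (hπ : v π = WithZero.exp (-1))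
    (happ : ∀ n : ℕ, ∃ a : K, v a ≤ 1 ∧
      O'.valuation (θ - algebraMap K L a) ≤ O'.valuation (algebraMap K L (π ^ (n + 1))))
    {x : L} (hx : x ≠ 0) :
    ∃ f : K, O'.valuation x = O'.valuation (algebraMap K L f) := by
  have heq := isEquiv_comap_of_comap_eq h
  obtain ⟨p, hp⟩ := exists_aeval_eq_of_adjoin_eq_top hgen x⁻¹
  obtain ⟨q, rfl⟩ := exists_aeval_eq_of_adjoin_eq_top hgen x
  -- a bound for `x⁻¹` bounds `x` from below
  obtain ⟨d, hd0, hd, -⟩ := exists_mul_aeval_bounded h hθ p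
  rw [hp, map_mul, map_inv₀, ← div_eq_mul_inv, div_le_one₀ (by simpa [zero_lt_iff] using hx)] at hd
  obtain ⟨e, he0, -, he⟩ := exists_mul_aeval_bounded h hθ q
  obtain ⟨n, hn⟩ := WithZero.exists_exp_neg_natCast_lt (x := v (d * e))
    (by simp [hd0, he0])
  obtain ⟨a, ha1, ha⟩ := happ n
  refine ⟨q.eval a, ?_⟩
  have hlt : O'.valuation (Polynomial.aeval θ q - algebraMap K L (q.eval a))
      < O'.valuation (Polynomial.aeval θ q) := by
    have hπn : v (π ^ (n + 1)) < v (d * e) := by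
      refine lt_of_le_of_lt ?_ hn
      rw [map_pow, hπ, ← WithZero.exp_nsmul, WithZero.exp_le_exp]
      simp
    have h1 := (he a ha1).trans ha
    have h2 : O'.valuation (algebraMap K L (π ^ (n + 1))) < O'.valuation (algebraMap K L (d * e)) :=
      heq.lt_iff_lt.mpr hπn
    have h3 := h1.trans_lt h2
    rw [map_mul, map_mul, map_mul, mul_comm (O'.valuation (algebraMap K L d))] at h3
    exact (lt_of_mul_lt_mul_left h3 zero_le).trans_le hd
  have := Valuation.map_sub_eq_of_lt_left O'.valuation hlt
  rw [← this, sub_sub_cancel]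

/-- An extension `L = K(θ)` of degree three is unramified at `O'` if the integral element `θ` is a
root of a polynomial `g` over the valuation ring of `K` and `g'(θ)` is a unit. -/
theorem unitGroup_sup_range_eq_top (h : O'.comap (algebraMap K L) = v.valuationSubring)
    {π : K} (hπ : v π = WithZero.exp (-1)) (hdeg : Module.finrank K L = 3)
    {θ : L} (hgen : K⟮θ⟯ = ⊤) (g : v.valuationSubring[X]) (hθ : O'.valuation θ ≤ 1)
    (hg : g.eval₂ ((algebraMap K L).comp v.valuationSubring.subtype) θ = 0)
    (hg' : O'.valuation
      (g.derivative.eval₂ ((algebraMap K L).comp v.valuationSubring.subtype) θ) = 1) :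
    O'.unitGroup ⊔ (Units.map (algebraMap K L : K →* L)).range = ⊤ := by
  have := FiniteDimensional.of_finrank_eq_succ hdeg
  have heq := isEquiv_comap_of_comap_eq h
  have hπ0 : π ≠ 0 := by
    rintro rfl
    rw [map_zero] at hπ
    exact WithZero.exp_ne_zero hπ.symm
  rw [eq_top_iff]
  rintro x -
  rw [mem_unitGroup_sup_range_iff]
  by_cases hres : ∀ a : K, v a ≤ 1 → O'.valuation (θ - algebraMap K L a) = 1
  · exact exists_valuation_eq_of_residue_notMem h hdeg hθ hres x.ne_zero
  push Not at hres
  obtain ⟨a₀, ha₀, ha₀'⟩ := hres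
  let j : v.valuationSubring →+* O' :=
    ((algebraMap K L).comp v.valuationSubring.subtype).codRestrict O'.toSubring (fun a => by
      have : (a : K) ∈ O'.comap (algebraMap K L) := by rw [h]; exact a.2
      exact this)
  have hj : ∀ a : v.valuationSubring, ((j a : O') : L) = algebraMap K L a := fun _ => rfl
  have hjO : O'.subtype.comp j = (algebraMap K L).comp v.valuationSubring.subtype := rfl
  have hunit : ∀ a : v.valuationSubring, IsUnit a ↔ v (a : K) = 1 := fun a => by
    rw [ValuationSubring.valuation_eq_one_iff,
      ← (Valuation.isEquiv_valuation_valuationSubring v).eq_one_iff_eq_one]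
  have hloc : IsLocalHom j := ⟨fun a ha => by
    rw [ValuationSubring.valuation_eq_one_iff, hj] at ha
    rw [hunit]
    exact heq.eq_one_iff_eq_one.mp ha⟩
  have hπ1 : v π ≤ 1 := by rw [hπ, ← WithZero.exp_zero, WithZero.exp_le_exp]; simp
  have hθO : θ ∈ O' := (ValuationSubring.valuation_le_one_iff _ _).mp hθ
  have happ := exists_pow_dvd_sub_of_simple_root j (π := ⟨π, hπ1⟩) (θ := ⟨θ, hθO⟩) ?_ ?_ g ?_ ?_ ?_
  · refine exists_valuation_eq_of_approx h hgen hθ hπ (fun n => ?_) x.ne_zero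
    obtain ⟨a, c, hc⟩ := happ n
    refine ⟨a, a.2, ?_⟩
    have hc' := congrArg (Subtype.val) hc
    have hc'' : θ - algebraMap K L a = algebraMap K L (π ^ (n + 1)) * c := by
      rw [map_pow]
      exact hc'
    rw [hc'', map_mul]
    exact mul_le_of_le_of_le_one le_rfl (ValuationSubring.valuation_le_one _ c)
  · intro a ha
    rw [hunit] at ha
    have hlt : v (a : K) < 1 := lt_of_le_of_ne a.2 ha
    have hle : v ((a : K) / π) ≤ 1 := by
      rw [map_div₀, hπ, div_le_one₀ (by simp)]
      rcases eq_or_ne (v (a : K)) 0 with h0 | h0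
      · simp [h0]
      rw [← WithZero.log_le_iff_le_exp h0]
      rw [← WithZero.exp_zero, ← WithZero.log_lt_iff_lt_exp h0] at hlt
      omega
    refine ⟨⟨_, hle⟩, Subtype.ext ?_⟩
    change (a : K) = π * (a / π)
    field_simp
  · intro hu
    have := isUnit_of_map_unit j _ hu
    rw [hunit] at this
    change v π = 1 at this
    rw [hπ, WithZero.exp_eq_one] at this
    omega
  · apply O'.subtype_injective
    rw [Polynomial.hom_eval₂, hjO, map_zero]
    exact hg
  · rw [ValuationSubring.valuation_eq_one_iff]
    have := Polynomial.hom_eval₂ g.derivative j O'.subtype ⟨θ, hθO⟩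
    rw [hjO] at this
    change ((_ : O') : L) = _ at this
    rw [this]
    exact hg'
  · refine ⟨⟨a₀, ha₀⟩, fun hu => ha₀' ?_⟩
    rw [ValuationSubring.valuation_eq_one_iff] at hu
    exact hu

/-! ### Ramification in pure cubic extensions -/

variable (L) in
lemma exists_valuationSubring_comap_eq (O : ValuationSubring K) :
    ∃ O' : ValuationSubring L, O'.comap (algebraMap K L) = O := by
  obtain ⟨A, hA, hloc⟩ :=
    IsLocalRing.exists_factor_valuationRing ((algebraMap K L).comp O.subtype)
  refine ⟨A, le_antisymm (fun x hx => ?_) (fun x hx => hA ⟨x, hx⟩)⟩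
  rcases O.mem_or_inv_mem x with h | h
  · exact h
  rcases eq_or_ne x 0 with rfl | hx0
  · exact O.zero_mem
  rw [ValuationSubring.mem_comap] at hx
  have hu : IsUnit (⟨x⁻¹, h⟩ : O) := by
    apply hloc.map_nonunit
    refine IsUnit.of_mul_eq_one (⟨algebraMap K L x, hx⟩ : A.toSubring) (Subtype.ext ?_)
    change algebraMap K L x⁻¹ * algebraMap K L x = 1
    rw [← map_mul, inv_mul_cancel₀ hx0, map_one]
  obtain ⟨c, hc⟩ := hu.exists_right_inv
  have hc' : x⁻¹ * (c : K) = 1 := congrArg Subtype.val hc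
  rw [inv_mul_eq_one₀ hx0] at hc'
  rw [hc']
  exact c.2

lemma exists_eq_quadratic_of_pow_three {R A : Type*} [CommRing R] [CommRing A] [Algebra R A]
    {y : A} {β : R} (hy : y ^ 3 = algebraMap R A β) {z : A} (hz : z ∈ Algebra.adjoin R {y}) :
    ∃ a b c : R, z = algebraMap R A a + algebraMap R A b * y + algebraMap R A c * y ^ 2 := by
  rw [Algebra.adjoin_singleton_eq_range_aeval] at hz
  obtain ⟨p, rfl⟩ := hz
  induction p using Polynomial.induction_on with
  | C a => exact ⟨a, 0, 0, by simp⟩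
  | add p q hp hq =>
    obtain ⟨a, b, c, h₁⟩ := hp
    obtain ⟨a', b', c', h₂⟩ := hq
    refine ⟨a + a', b + b', c + c', ?_⟩
    rw [map_add, h₁, h₂]
    simp only [map_add]
    ring
  | monomial n r h =>
    obtain ⟨a, b, c, h⟩ := h
    refine ⟨c * β, a, b, ?_⟩
    rw [pow_succ, ← mul_assoc, map_mul, h, map_mul,
      show (Polynomial.aeval y).toRingHom Polynomial.X = y from Polynomial.aeval_X y]
    linear_combination algebraMap R A c * hy

/-- If the value of `y ^ 3 ∈ K` is not divisible by three, every value of `L = K(y)` differs from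
one of `1`, `y`, `y ^ 2` by a value of `K`. -/
theorem ramificationIndex_eq_three (h : O'.comap (algebraMap K L) = v.valuationSubring)
    (hdeg : Module.finrank K L = 3) {y : L} (hgen : K⟮y⟯ = ⊤) {β : K} (hβ : β ≠ 0)
    (hy : y ^ 3 = algebraMap K L β) (hram : ¬ (3 : ℤ) ∣ WithZero.log (v β)) :
    ramificationIndex K O' = 3 := by
  have := FiniteDimensional.of_finrank_eq_succ hdeg
  have heq := isEquiv_comap_of_comap_eq h
  have hβ' : algebraMap K L β ≠ 0 := by simpa using hβ
  have hy0 : y ≠ 0 := by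
    rintro rfl
    exact hβ' (by rw [← hy]; simp)
  let Y : Lˣ := Units.mk0 y hy0
  set H := O'.unitGroup ⊔ (Units.map (algebraMap K L : K →* L)).range with hH
  have hY3 : Y ^ 3 ∈ H := by
    rw [hH, mem_unitGroup_sup_range_iff]
    exact ⟨β, by rw [← hy]; rfl⟩
  have hY1 : Y ∉ H := by
    rw [hH, mem_unitGroup_sup_range_iff]
    rintro ⟨f, hf⟩
    apply hram
    have h1 : O'.valuation (algebraMap K L β) = O'.valuation (algebraMap K L (f ^ 3)) := by
      rw [← hy, map_pow, map_pow, map_pow, ← hf]; rfl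
    have h2 : v β = v (f ^ 3) :=
      le_antisymm (heq.le_iff_le.mp h1.le) (heq.le_iff_le.mp h1.ge)
    rw [h2, map_pow, WithZero.log_pow]
    exact ⟨WithZero.log (v f), by simp⟩
  have hY2 : Y ^ 2 ∉ H := fun h2 => hY1 (by
    have : Y = Y ^ 3 * (Y ^ 2)⁻¹ := by group
    rw [this]
    exact H.mul_mem hY3 (H.inv_mem h2))
  have hord : orderOf (QuotientGroup.mk (s := H) Y) = 3 := by
    apply orderOf_eq_prime
    · rw [← QuotientGroup.mk_pow]
      exact (QuotientGroup.eq_one_iff _).mpr hY3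
    · exact fun h1 => hY1 ((QuotientGroup.eq_one_iff _).mp h1)
  have hval : ∀ f : K, f ≠ 0 → ∀ n : ℕ, ∀ x : Lˣ,
      O'.valuation x = O'.valuation (algebraMap K L f * y ^ n) → x * (Y ^ n)⁻¹ ∈ H := by
    intro f hf n x hx
    rw [hH, mem_unitGroup_sup_range_iff]
    refine ⟨f, ?_⟩
    have : O'.valuation y ^ n ≠ 0 := pow_ne_zero _ (by simpa using hy0)
    rw [Units.val_mul, map_mul, hx, map_mul, map_pow, Units.val_inv_eq_inv_val,
      Units.val_pow_eq_pow_val, map_inv₀, map_pow]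
    exact mul_inv_cancel_right₀ this _
  -- the terms of `a + b y + c y ^ 2` have pairwise distinct values
  have hne : ∀ f g : K, f ≠ 0 → ∀ i j : ℕ, i < j → j < 3 →
      O'.valuation (algebraMap K L f * y ^ i) ≠ O'.valuation (algebraMap K L g * y ^ j) := by
    intro f g hf i j hij hj h1
    have hg : g ≠ 0 := by
      rintro rfl
      rw [map_zero, zero_mul, map_zero, map_eq_zero] at h1
      exact (mul_ne_zero (by simpa using hf) (pow_ne_zero _ hy0)) h1
    have hf' : algebraMap K L f ≠ 0 := by simpa using hf
    let x : Lˣ := Units.mk0 (algebraMap K L f * y ^ i) (mul_ne_zero hf' (pow_ne_zero _ hy0))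
    have h2 := H.mul_mem (H.inv_mem (hval g hg j x h1)) (hval f hf i x rfl)
    have h3 : (x * (Y ^ j)⁻¹)⁻¹ * (x * (Y ^ i)⁻¹) = Y ^ (j - i) := by
      rw [mul_inv, inv_inv, mul_mul_mul_comm, inv_mul_cancel, one_mul, ← pow_sub _ hij.le]
    rw [h3] at h2
    interval_cases j <;> interval_cases i <;> simp at h2 <;> first | exact hY1 h2 | exact hY2 h2
  have hpoly : ∀ z : L, ∃ a b c : K,
      z = algebraMap K L a * y ^ 0 + algebraMap K L b * y ^ 1 + algebraMap K L c * y ^ 2 := by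
    intro z
    obtain ⟨q, rfl⟩ := exists_aeval_eq_of_adjoin_eq_top hgen z
    obtain ⟨a, b, c, h1⟩ :=
      exists_eq_quadratic_of_pow_three hy (Polynomial.aeval_mem_adjoin_singleton K y (p := q))
    exact ⟨a, b, c, by rw [h1]; ring⟩
  have htop : ∀ x : Lˣ, ∃ n : ℕ, x * (Y ^ n)⁻¹ ∈ H := by
    intro x
    obtain ⟨a, b, c, hx⟩ := hpoly x
    have hmax : ∃ f : K, f ≠ 0 ∧ ∃ n, O'.valuation x = O'.valuation (algebraMap K L f * y ^ n) := by
      have hpair : ∀ (p q : L), O'.valuation p ≠ O'.valuation q →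
          O'.valuation (p + q) = O'.valuation p ∨ O'.valuation (p + q) = O'.valuation q := by
        intro p q hpq
        rw [Valuation.map_add_of_distinct_val _ hpq]
        exact max_choice _ _
      have hx0 : (x : L) ≠ 0 := x.ne_zero
      have hab : algebraMap K L a * y ^ 0 + algebraMap K L b * y ^ 1 = 0 ∨
          ∃ f : K, f ≠ 0 ∧ ∃ n < 2,
            O'.valuation (algebraMap K L a * y ^ 0 + algebraMap K L b * y ^ 1) =
              O'.valuation (algebraMap K L f * y ^ n) := by
        rcases eq_or_ne a 0 with rfl | ha
        · rcases eq_or_ne b 0 with rfl | hb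
          · left; simp
          · exact Or.inr ⟨b, hb, 1, by norm_num, by simp⟩
        · right
          rcases eq_or_ne b 0 with rfl | hb
          · exact ⟨a, ha, 0, by norm_num, by simp⟩
          rcases hpair _ _ (hne a b ha 0 1 (by norm_num) (by norm_num)) with h1 | h1
          · exact ⟨a, ha, 0, by norm_num, h1⟩
          · exact ⟨b, hb, 1, by norm_num, h1⟩
      rw [hx] at hx0 ⊢
      rcases hab with h0 | ⟨f, hf, n, hn, hv⟩
      · rw [h0, zero_add] at hx0 ⊢
        exact ⟨c, fun hc => hx0 (by rw [hc, map_zero, zero_mul]), 2, rfl⟩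
      · have hd : O'.valuation (algebraMap K L a * y ^ 0 + algebraMap K L b * y ^ 1) ≠
            O'.valuation (algebraMap K L c * y ^ 2) := by
          rw [hv]; exact hne f c hf n 2 hn (by norm_num)
        rcases hpair _ _ hd with h1 | h1
        · exact ⟨f, hf, n, h1.trans hv⟩
        · refine ⟨c, fun hc => ?_, 2, h1⟩
          rw [hc, map_zero, zero_mul, map_zero, map_eq_zero] at h1
          rw [hc, map_zero, zero_mul] at hx0
          exact hx0 h1
    obtain ⟨f, hf, n, hn⟩ := hmax
    exact ⟨n, hval f hf n x hn⟩
  rw [ramificationIndex, ← hH, ← hord, Subgroup.index, ← Nat.card_zpowers,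
    show Subgroup.zpowers (QuotientGroup.mk (s := H) Y) = ⊤ from
      (Subgroup.eq_top_iff' _).mpr ?_, Subgroup.card_top]
  intro q
  induction q using QuotientGroup.induction_on with
  | H x =>
    obtain ⟨n, hn⟩ := htop x
    refine ⟨n, ?_⟩
    change (QuotientGroup.mk (s := H) Y) ^ (n : ℤ) = _
    rw [zpow_natCast, ← QuotientGroup.mk_pow, QuotientGroup.eq, mul_comm]
    exact hn

end Extension

/-- A place of `K` is fully ramified in `L = K(y)`, where `y ^ 3 = β`, exactly if its normalized
valuation of `β` is not divisible by three. -/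
theorem mem_fullyRamifiedPlaces_iff {k K L : Type*} [Field k] [Field K] [Field L] [Algebra k K]
    [Algebra K L] {v : Valuation K (WithZero (Multiplicative ℤ))} {π : K}
    (hπ : v π = WithZero.exp (-1)) (h3 : v 3 = 1) (hdeg : Module.finrank K L = 3)
    {y : L} (hgen : K⟮y⟯ = ⊤) {β : K} (hβ : β ≠ 0) (hy : y ^ 3 = algebraMap K L β)
    (p : Place k K) (hp : p.1 = v.valuationSubring) :
    p ∈ fullyRamifiedPlaces k K L ↔ ¬ (3 : ℤ) ∣ WithZero.log (v β) := by
  constructor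
  · rintro ⟨O', hO', hram⟩ ⟨m, hm⟩
    rw [hp] at hO'
    have heq := isEquiv_comap_of_comap_eq hO'
    -- scale `y` to a unit at the place
    have hπ0 : π ≠ 0 := by
      rintro rfl
      rw [map_zero] at hπ
      exact WithZero.exp_ne_zero hπ.symm
    have hπL : algebraMap K L π ≠ 0 := by simpa using hπ0
    have hvβ : v (β * (π ^ m) ^ 3) = 1 := by
      rw [map_mul, map_pow, map_zpow₀, hπ, ← WithZero.exp_zsmul,
        ← WithZero.exp_nsmul, ← WithZero.exp_log (x := v β) (by simpa using hβ), hm,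
        ← WithZero.exp_add]
      simp
    have hθ3 : (y * algebraMap K L (π ^ m)) ^ 3 = algebraMap K L (β * (π ^ m) ^ 3) := by
      rw [mul_pow, hy, map_mul, map_pow]
    have hθ1 : O'.valuation (y * algebraMap K L (π ^ m)) = 1 := by
      have : O'.valuation (y * algebraMap K L (π ^ m)) ^ 3 = 1 := by
        rw [← map_pow, hθ3]
        exact heq.eq_one_iff_eq_one.mpr hvβ
      exact (pow_eq_one_iff_of_nonneg zero_le (by norm_num)).mp this
    have hgen' : K⟮y * algebraMap K L (π ^ m)⟯ = ⊤ := by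
      rw [eq_top_iff, ← hgen, IntermediateField.adjoin_simple_le_iff]
      have h1 := IntermediateField.mem_adjoin_simple_self K (y * algebraMap K L (π ^ m))
      have h2 := IntermediateField.algebraMap_mem K⟮y * algebraMap K L (π ^ m)⟯ (π ^ m)
      have h3 := div_mem h1 h2
      rwa [mul_div_cancel_right₀ _ (by rw [map_zpow₀]; exact zpow_ne_zero _ hπL)] at h3
    have htop := unitGroup_sup_range_eq_top hO' hπ hdeg hgen'
      (Polynomial.X ^ 3 - Polynomial.C ⟨_, hvβ.le⟩) hθ1.le ?_ ?_
    · rw [ramificationIndex, htop, Subgroup.index_top, hdeg] at hram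
      omega
    · rw [Polynomial.eval₂_sub, Polynomial.eval₂_pow, Polynomial.eval₂_X, Polynomial.eval₂_C, hθ3]
      exact sub_self _
    · have h3' : O'.valuation 3 = 1 := by
        rw [← map_ofNat (algebraMap K L) 3]
        exact heq.eq_one_iff_eq_one.mpr h3
      have hder : Polynomial.derivative (Polynomial.X ^ 3 - Polynomial.C ⟨_, hvβ.le⟩ :
          v.valuationSubring[X]) = 3 * Polynomial.X ^ 2 := by
        simp only [Polynomial.derivative_sub, Polynomial.derivative_X_pow, Polynomial.derivative_C,
          sub_zero, Nat.cast_ofNat, map_ofNat]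
      rw [hder, Polynomial.eval₂_mul, Polynomial.eval₂_pow, Polynomial.eval₂_X,
        Polynomial.eval₂_ofNat, map_mul, map_pow, hθ1, h3']
      simp
  · intro hram
    obtain ⟨O', hO'⟩ := exists_valuationSubring_comap_eq L v.valuationSubring
    exact ⟨O', hO'.trans hp.symm, by
      rw [hdeg]; exact ramificationIndex_eq_three hO' hdeg hgen hβ hy hram⟩

/-! ### Places of the rational function field -/

section Order

variable {k : Type*} [Field k]

/-- The order of vanishing of a rational function at the place given by `P`; it is `0` at the
zero function. -/
def ordAt (P : k[X]) (hP : Irreducible P) (f : RatFunc k) : ℤ :=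
  -WithZero.log ((primeIdeal P hP).valuation (RatFunc k) f)

variable {P : k[X]} (hP : Irreducible P)

lemma ordAt_mul {f g : RatFunc k} (hf : f ≠ 0) (hg : g ≠ 0) :
    ordAt P hP (f * g) = ordAt P hP f + ordAt P hP g := by
  rw [ordAt, map_mul, WithZero.log_mul (by simpa using hf) (by simpa using hg)]
  simp only [ordAt]; ring

lemma ordAt_zpow (f : RatFunc k) (n : ℤ) : ordAt P hP (f ^ n) = n * ordAt P hP f := by
  rw [ordAt, map_zpow₀, WithZero.log_zpow, ordAt, smul_eq_mul, mul_neg]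

lemma ordAt_pow (f : RatFunc k) (n : ℕ) : ordAt P hP (f ^ n) = n * ordAt P hP f := by
  rw [← zpow_natCast, ordAt_zpow]

lemma ordAt_prod {ι : Type*} (s : Finset ι) (f : ι → RatFunc k) (hf : ∀ i ∈ s, f i ≠ 0) :
    ordAt P hP (∏ i ∈ s, f i) = ∑ i ∈ s, ordAt P hP (f i) := by
  classical
  induction s using Finset.induction_on with
  | empty => simp [ordAt]
  | insert a s ha ih =>
    rw [Finset.prod_insert ha, Finset.sum_insert ha,
      ordAt_mul hP (hf a (Finset.mem_insert_self a s))
      (Finset.prod_ne_zero_iff.mpr fun i hi => hf i (Finset.mem_insert_of_mem hi)),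
      ih fun i hi => hf i (Finset.mem_insert_of_mem hi)]

lemma ordAt_of_not_dvd {f : k[X]} (h : ¬ P ∣ f) :
    ordAt P hP (algebraMap k[X] (RatFunc k) f) = 0 := by
  have : (primeIdeal P hP).valuation (RatFunc k) (algebraMap k[X] (RatFunc k) f) = 1 := by
    rw [IsDedekindDomain.HeightOneSpectrum.valuation_eq_one_iff_notMem]
    exact fun hm => h (Ideal.mem_span_singleton.mp hm)
  rw [ordAt, this, WithZero.log_one, neg_zero]

lemma valuation_self : (primeIdeal P hP).valuation (RatFunc k) (algebraMap k[X] (RatFunc k) P) =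
    WithZero.exp (-1) := by
  rw [IsDedekindDomain.HeightOneSpectrum.valuation_of_algebraMap]
  exact IsDedekindDomain.HeightOneSpectrum.intValuation_singleton _ hP.ne_zero rfl

lemma ordAt_self : ordAt P hP (algebraMap k[X] (RatFunc k) P) = 1 := by
  rw [ordAt, valuation_self]
  simp

lemma ordAt_C {c : k} (hc : c ≠ 0) : ordAt P hP (RatFunc.C c) = 0 := by
  rw [← RatFunc.algebraMap_C]
  exact ordAt_of_not_dvd hP fun h => hP.not_isUnit
    (isUnit_of_dvd_unit h (Polynomial.isUnit_C.mpr hc.isUnit))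

lemma ordAt_of_ne {Q : k[X]} (hPm : P.Monic) (hQm : Q.Monic) (hQ : Irreducible Q) (h : P ≠ Q) :
    ordAt P hP (algebraMap k[X] (RatFunc k) Q) = 0 :=
  ordAt_of_not_dvd hP fun hd => h (Polynomial.eq_of_monic_of_associated hPm hQm
    (hP.associated_of_dvd hQ hd))

lemma finitePlace_injective {Q : k[X]} (hPm : P.Monic) (hQm : Q.Monic) (hQ : Irreducible Q)
    (h : finitePlace P hP = finitePlace Q hQ) : P = Q := by
  have h1 : (primeIdeal P hP) = (primeIdeal Q hQ) := by
    apply IsDedekindDomain.HeightOneSpectrum.eq_of_valuation_isEquiv_valuation (K := RatFunc k)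
    rw [Valuation.isEquiv_iff_valuationSubring]
    exact congrArg Subtype.val h
  have h2 : Ideal.span {P} = Ideal.span {Q} := congrArg (·.asIdeal) h1
  exact Polynomial.eq_of_monic_of_associated hPm hQm (Ideal.span_singleton_eq_span_singleton.mp h2)

lemma inftyPlace_val [DecidableEq (RatFunc k)] :
    (inftyPlace k).1 = (RatFunc.inftyValuation k).valuationSubring := by
  unfold inftyPlace
  congr!

lemma finitePlace_ne_inftyPlace : finitePlace P hP ≠ inftyPlace k := by
  classical
  intro h
  have h1 := RatFunc.adicValuation_not_isEquiv_infty_valuation (primeIdeal P hP)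
  apply h1
  rw [Valuation.isEquiv_iff_valuationSubring]
  exact (congrArg Subtype.val h).trans inftyPlace_val

/-- The places of `k(x)` are the place at infinity and those given by monic irreducible
polynomials. -/
theorem eq_inftyPlace_or_exists_finitePlace (p : Place k (RatFunc k)) :
    p = inftyPlace k ∨ ∃ (P : k[X]) (_ : P.Monic) (hP : Irreducible P), p = finitePlace P hP := by
  classical
  obtain ⟨O, hk, hO⟩ := p
  have htriv : O.valuation.IsTrivialOn k := ⟨fun c hc => by
    have h1 := (ValuationSubring.valuation_le_one_iff _ _).mpr (hk c)
    have h2 := (ValuationSubring.valuation_le_one_iff _ _).mpr (hk c⁻¹)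
    rw [map_inv₀, map_inv₀] at h2
    have h0 : O.valuation (algebraMap k (RatFunc k) c) ≠ 0 := by simpa using hc
    exact le_antisymm h1 ((inv_le_one₀ (zero_lt_iff.mpr h0)).mp h2)⟩
  have hnt : O.valuation.IsNontrivial := by
    by_contra h
    exact hO (ValuationSubring.eq_top_iff _ |>.mpr h)
  rcases lt_or_ge 1 (O.valuation RatFunc.X) with hX | hX
  · left
    apply Subtype.ext
    have := RatFunc.valuation_isEquiv_inftyValuation_of_one_lt_valuation_X hX
    rw [Valuation.isEquiv_iff_valuationSubring, ValuationSubring.valuationSubring_valuation] at this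
    exact this.trans inftyPlace_val.symm
  · right
    let Q := RatFunc.uniformizingPolynomial hX
    have hQ : Irreducible Q := RatFunc.irreducible_min_polynomial_valuation_lt_one_and_ne_zero _
    let P := normalize Q
    have hPm : P.Monic := Polynomial.monic_normalize hQ.ne_zero
    have hPQ : Associated P Q := normalize_associated Q
    have hP : Irreducible P := hPQ.irreducible_iff.mpr hQ
    refine ⟨P, hPm, hP, Subtype.ext (Eq.symm ?_)⟩
    have hpol : ∀ f : k[X], O.valuation (algebraMap k[X] (RatFunc k) f) ≤ 1 :=
      fun f => Polynomial.valuation_le_one_of_valuation_X_le_one _ hX f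
    have hQ1 : O.valuation (algebraMap k[X] (RatFunc k) Q) < 1 :=
      RatFunc.valuation_uniformizingPolynomial_lt_one hX
    have hone : ∀ f : k[X], ¬ P ∣ f → O.valuation (algebraMap k[X] (RatFunc k) f) = 1 := by
      intro f hf
      refine le_antisymm (hpol f) (not_lt.mp fun hlt => ?_)
      -- Bézout for the coprime polynomials `Q` and `f`
      obtain ⟨a, b, hab⟩ := (hQ.coprime_iff_not_dvd).mpr fun h => hf (hPQ.dvd.trans h)
      have h1 : O.valuation (algebraMap k[X] (RatFunc k) (a * Q + b * f)) < 1 := by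
        rw [map_add, map_mul, map_mul]
        refine Valuation.map_add_lt _ ?_ ?_
        · rw [map_mul]; exact (mul_le_of_le_one_left' (hpol a)).trans_lt hQ1
        · rw [map_mul]; exact (mul_le_of_le_one_left' (hpol b)).trans_lt hlt
      rw [hab, map_one, map_one] at h1
      exact lt_irrefl _ h1
    have hle : (finitePlace P hP).1 ≤ O := by
      intro f hf
      obtain ⟨n, d, hnd⟩ :=
        (primeIdeal P hP).exists_primeCompl_mul_eq_of_integer f hf
      have hd := hone d fun h => d.2 (Ideal.mem_span_singleton.mpr h)
      rw [← ValuationSubring.valuation_le_one_iff]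
      have := congrArg O.valuation hnd
      rw [map_mul, hd, mul_one] at this
      rw [this]
      exact hpol n
    refine le_antisymm hle fun f hf => ?_
    by_contra hcon
    have hlt : 1 < (primeIdeal P hP).valuation (RatFunc k) f := not_le.mp hcon
    have hlt' : (primeIdeal P hP).valuation (RatFunc k) f⁻¹ < 1 := by
      rw [map_inv₀]; exact inv_lt_one_of_one_lt₀ hlt
    obtain ⟨n, d, hnd⟩ := (primeIdeal P hP).exists_primeCompl_mul_eq_of_integer f⁻¹ hlt'.le
    have hd := hone d fun h => d.2 (Ideal.mem_span_singleton.mpr h)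
    have hn : P ∣ n := by
      rw [← Ideal.mem_span_singleton]
      change n ∈ (primeIdeal P hP).asIdeal
      refine ((primeIdeal P hP).valuation_lt_one_iff_mem (K := RatFunc k) n).mp ?_
      refine lt_of_eq_of_lt (congrArg _ hnd.symm) ?_
      rw [map_mul]
      exact (mul_le_of_le_one_right'
        (IsDedekindDomain.HeightOneSpectrum.valuation_le_one _ _)).trans_lt hlt'
    obtain ⟨c, rfl⟩ := hPQ.symm.dvd.trans hn
    have h1 := congrArg O.valuation hnd
    rw [map_mul, hd, mul_one, map_mul, map_mul] at h1
    have h2 : O.valuation f⁻¹ < 1 := by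
      rw [h1]; exact (mul_le_of_le_one_right' (hpol c)).trans_lt hQ1
    have hf0 : f ≠ 0 := by
      rintro rfl
      exact hcon (zero_mem _)
    rw [map_inv₀, inv_lt_one₀ (zero_lt_iff.mpr (by simpa using hf0))] at h2
    exact not_le.mpr h2 ((ValuationSubring.valuation_le_one_iff _ _).mpr hf)

end Order

section Ramification

variable {k : Type*} [Field k] {L : Type*} [Field L] [Algebra (RatFunc k) L]

lemma finitePlace_mem_fullyRamifiedPlaces_iff (h3 : (3 : k) ≠ 0)
    (hdeg : Module.finrank (RatFunc k) L = 3) {y : L} (hgen : (RatFunc k)⟮y⟯ = ⊤) {β : RatFunc k}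
    (hβ : β ≠ 0) (hy : y ^ 3 = algebraMap (RatFunc k) L β) {P : k[X]} (hP : Irreducible P) :
    finitePlace P hP ∈ fullyRamifiedPlaces k (RatFunc k) L ↔ ¬ (3 : ℤ) ∣ ordAt P hP β := by
  rw [mem_fullyRamifiedPlaces_iff (valuation_self hP) ?_ hdeg hgen hβ hy _ rfl, ordAt, dvd_neg]
  have : (3 : RatFunc k) = algebraMap k[X] (RatFunc k) (Polynomial.C 3) := by
    rw [map_ofNat, map_ofNat]
  rw [this, IsDedekindDomain.HeightOneSpectrum.valuation_eq_one_iff_notMem]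
  intro hm
  exact hP.not_isUnit (isUnit_of_dvd_unit (Ideal.mem_span_singleton.mp hm)
    (Polynomial.isUnit_C.mpr h3.isUnit))

lemma inftyPlace_mem_fullyRamifiedPlaces_iff (h3 : (3 : k) ≠ 0)
    (hdeg : Module.finrank (RatFunc k) L = 3) {y : L} (hgen : (RatFunc k)⟮y⟯ = ⊤) {β : RatFunc k}
    (hβ : β ≠ 0) (hy : y ^ 3 = algebraMap (RatFunc k) L β) :
    inftyPlace k ∈ fullyRamifiedPlaces k (RatFunc k) L ↔ ¬ (3 : ℤ) ∣ β.intDegree := by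
  classical
  have hlog : WithZero.log (RatFunc.inftyValuation k β) = β.intDegree := by
    rw [RatFunc.inftyValuation_apply, RatFunc.inftyValuation_of_nonzero k hβ, WithZero.log_exp]
  rw [mem_fullyRamifiedPlaces_iff (v := RatFunc.inftyValuation k)
    (RatFunc.inftyValuation.X_inv k) ?_ hdeg hgen hβ hy _ inftyPlace_val, hlog]
  rw [← map_ofNat RatFunc.C 3, RatFunc.inftyValuation.C k h3]

end Ramification

/-! ### Radicands -/

section Cube

variable {k : Type*} [Field k]

lemma algebraMap_poly_ne_zero {P : k[X]} (hP : P ≠ 0) : algebraMap k[X] (RatFunc k) P ≠ 0 := by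
  simpa using hP

lemma exists_eq_C_mul_pow_three_of_polynomial (f : k[X]) (hf : f ≠ 0)
    (h : ∀ (Q : k[X]) (_ : Q.Monic) (hQ : Irreducible Q),
      (3 : ℤ) ∣ ordAt Q hQ (algebraMap k[X] (RatFunc k) f)) :
    ∃ (u : k) (c : k[X]), u ≠ 0 ∧ c ≠ 0 ∧ f = Polynomial.C u * c ^ 3 := by
  induction hn : f.natDegree using Nat.strong_induction_on generalizing f with
  | _ n ih =>
    by_cases hu : IsUnit f
    · obtain ⟨u, hu', rfl⟩ := Polynomial.isUnit_iff.mp hu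
      exact ⟨u, 1, hu'.ne_zero, one_ne_zero, by simp⟩
    obtain ⟨Q, hQm, hQ, hQf⟩ := Polynomial.exists_monic_irreducible_factor f hu
    obtain ⟨m, b, hb, rfl⟩ := WfDvdMonoid.max_power_factor hf hQ
    have hb0 : b ≠ 0 := right_ne_zero_of_mul hf
    have hord : ∀ (R : k[X]) (hR : Irreducible R),
        ordAt R hR (algebraMap k[X] (RatFunc k) (Q ^ m * b)) =
          m * ordAt R hR (algebraMap k[X] (RatFunc k) Q) +
            ordAt R hR (algebraMap k[X] (RatFunc k) b) := by
      intro R hR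
      rw [map_mul, map_pow, ordAt_mul hR (pow_ne_zero _ (algebraMap_poly_ne_zero hQ.ne_zero))
        (algebraMap_poly_ne_zero hb0), ordAt_pow]
    have hm := h Q hQm hQ
    rw [hord, ordAt_self, ordAt_of_not_dvd hQ hb] at hm
    obtain ⟨l, rfl⟩ : 3 ∣ m := by omega
    have hl : l ≠ 0 := by
      rintro rfl
      apply hb
      simpa using hQf
    obtain ⟨u, c, hu0, hc0, hc⟩ := ih b.natDegree (by
        rw [← hn, Polynomial.natDegree_mul (pow_ne_zero _ hQ.ne_zero) hb0,
          Polynomial.natDegree_pow]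
        have := hQ.natDegree_pos
        have : 0 < 3 * l * Q.natDegree := by positivity
        omega) b hb0 (fun R hRm hR => by
        have := h R hRm hR
        rw [hord] at this
        push_cast at this
        rw [mul_assoc] at this
        exact (Int.dvd_add_right (dvd_mul_right _ _)).mp this) rfl
    refine ⟨u, Q ^ l * c, hu0, mul_ne_zero (pow_ne_zero _ hQ.ne_zero) hc0, ?_⟩
    nth_rewrite 1 [hc]
    ring

/-- A rational function all of whose orders at finite places are divisible by three is a constant
times a cube. -/
lemma exists_eq_C_mul_pow_three {f : RatFunc k} (hf : f ≠ 0)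
    (h : ∀ (Q : k[X]) (_ : Q.Monic) (hQ : Irreducible Q), (3 : ℤ) ∣ ordAt Q hQ f) :
    ∃ (u : k) (c : RatFunc k), u ≠ 0 ∧ c ≠ 0 ∧ f = RatFunc.C u * c ^ 3 := by
  have hn : f.num ≠ 0 := RatFunc.num_ne_zero hf
  have hd : f.denom ≠ 0 := f.denom_ne_zero
  have hd' := algebraMap_poly_ne_zero hd
  have hfd : algebraMap k[X] (RatFunc k) (f.num * f.denom ^ 2) =
      f * algebraMap k[X] (RatFunc k) f.denom ^ 3 := by
    nth_rewrite 3 [← f.num_div_denom]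
    rw [map_mul, map_pow]
    field_simp
  obtain ⟨u, c, hu, hc, hfc⟩ := exists_eq_C_mul_pow_three_of_polynomial (f.num * f.denom ^ 2)
    (mul_ne_zero hn (pow_ne_zero _ hd)) (fun Q hQm hQ => by
      rw [hfd, ordAt_mul hQ hf (pow_ne_zero _ hd'), ordAt_pow]
      exact dvd_add (h Q hQm hQ) (dvd_mul_right _ _))
  refine ⟨u, algebraMap k[X] (RatFunc k) c / algebraMap k[X] (RatFunc k) f.denom, hu,
    div_ne_zero (algebraMap_poly_ne_zero hc) hd', ?_⟩
  rw [hfc, map_mul, map_pow, RatFunc.algebraMap_C] at hfd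
  rw [div_pow, ← mul_div_assoc, hfd, mul_div_cancel_right₀ _ (pow_ne_zero _ hd')]

end Cube

section Radicand

variable {k : Type*} [Field k] (P : ℕ → {p : k[X] // p.Monic ∧ Irreducible p})

/-- The product of the `P i ^ e i` for `1 ≤ i ≤ n`. -/
def primeProd (n : ℕ) (e : ℕ → ℤ) : RatFunc k :=
  ∏ i ∈ Finset.Icc 1 n, algebraMap k[X] (RatFunc k) (P i).1 ^ e i

/-- The sign by which the exponent of `P i` in `radicand` differs from `ε i`: it is `-1` for the
polynomials in the denominator. -/
def orient (s r i : ℕ) : ℤ := if s < i ∧ i ≤ r then -1 else 1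

lemma orient_eq_or (s r i : ℕ) : orient s r i = 1 ∨ orient s r i = -1 := by
  unfold orient; split_ifs <;> simp

lemma orient_mul_self (s r i : ℕ) : orient s r i * orient s r i = 1 := by
  rcases orient_eq_or s r i with h | h <;> rw [h] <;> norm_num

lemma radicand_eq {s r n : ℕ} (hsr : s ≤ r) (hrn : r ≤ n) (u : k) (ε : ℕ → ℤ) :
    radicand P s r n u ε = RatFunc.C u * primeProd P n (fun i => orient s r i * ε i) := by
  have h1 : Finset.Icc 1 n = Finset.Icc 1 s ∪ (Finset.Icc (s + 1) r ∪ Finset.Icc (r + 1) n) := by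
    ext i; simp only [Finset.mem_Icc, Finset.mem_union]; omega
  rw [radicand, primeProd, h1, Finset.prod_union, Finset.prod_union, mul_assoc, div_eq_inv_mul,
    ← Finset.prod_inv_distrib]
  · congr 2
    · refine Finset.prod_congr rfl fun i hi => ?_
      rw [Finset.mem_Icc] at hi
      rw [orient, if_neg (by omega), one_mul]
    · congr 1
      · refine Finset.prod_congr rfl fun i hi => ?_
        rw [Finset.mem_Icc] at hi
        rw [orient, if_pos (by omega), neg_one_mul, zpow_neg]
      · refine Finset.prod_congr rfl fun i hi => ?_
        rw [Finset.mem_Icc] at hi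
        rw [orient, if_neg (by omega), one_mul]
  · rw [Finset.disjoint_left]; intro i; simp only [Finset.mem_Icc]; omega
  · rw [Finset.disjoint_left]; intro i; simp only [Finset.mem_Icc, Finset.mem_union]; omega

lemma primeProd_congr {n : ℕ} {e e' : ℕ → ℤ} (h : ∀ i ∈ Finset.Icc 1 n, e i = e' i) :
    primeProd P n e = primeProd P n e' :=
  Finset.prod_congr rfl fun i hi => by rw [h i hi]

lemma poly_zpow_ne_zero (i : ℕ) (m : ℤ) : algebraMap k[X] (RatFunc k) (P i).1 ^ m ≠ 0 :=
  zpow_ne_zero _ (algebraMap_poly_ne_zero (P i).2.2.ne_zero)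

lemma primeProd_ne_zero (n : ℕ) (e : ℕ → ℤ) : primeProd P n e ≠ 0 :=
  Finset.prod_ne_zero_iff.mpr fun i _ => poly_zpow_ne_zero P i _

lemma ratFuncC_ne_zero {u : k} (hu : u ≠ 0) : (RatFunc.C u : RatFunc k) ≠ 0 := by simpa using hu

lemma primeProd_neg (n : ℕ) (e : ℕ → ℤ) : primeProd P n (fun i => -e i) = (primeProd P n e)⁻¹ := by
  simp only [primeProd, zpow_neg, Finset.prod_inv_distrib]

variable {P}

lemma ordAt_primeProd_of_ne {Q : k[X]} (hQm : Q.Monic) (hQ : Irreducible Q) {n : ℕ} {u : k}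
    (hu : u ≠ 0) (e : ℕ → ℤ) (h : ∀ i ∈ Finset.Icc 1 n, Q ≠ (P i).1) :
    ordAt Q hQ (RatFunc.C u * primeProd P n e) = 0 := by
  rw [ordAt_mul hQ (ratFuncC_ne_zero hu) (primeProd_ne_zero P n e), ordAt_C hQ hu, primeProd,
    ordAt_prod hQ _ _ fun i _ => poly_zpow_ne_zero P i _, zero_add]
  refine Finset.sum_eq_zero fun i hi => ?_
  rw [ordAt_zpow, ordAt_of_ne hQ hQm (P i).2.1 (P i).2.2 (h i hi), mul_zero]

lemma ordAt_primeProd {n : ℕ} (hinj : Set.InjOn P (Set.Icc 1 n)) {u : k} (hu : u ≠ 0) (e : ℕ → ℤ)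
    {j : ℕ} (hj : j ∈ Finset.Icc 1 n) :
    ordAt (P j).1 (P j).2.2 (RatFunc.C u * primeProd P n e) = e j := by
  rw [ordAt_mul _ (ratFuncC_ne_zero hu) (primeProd_ne_zero P n e), ordAt_C _ hu, primeProd,
    ordAt_prod _ _ _ fun i _ => poly_zpow_ne_zero P i _, zero_add, Finset.sum_eq_single_of_mem j hj,
    ordAt_zpow, ordAt_self, mul_one]
  intro i hi hij
  rw [ordAt_zpow, ordAt_of_ne _ (P j).2.1 (P i).2.1 (P i).2.2, mul_zero]
  exact fun h => hij (hinj (by simpa using hi) (by simpa using hj) (Subtype.ext h.symm))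

lemma intDegree_zpow {f : RatFunc k} (hf : f ≠ 0) (m : ℤ) :
    (f ^ m).intDegree = m * f.intDegree := by
  classical
  have h1 : ∀ g : RatFunc k, g ≠ 0 → WithZero.log (RatFunc.inftyValuation k g) = g.intDegree :=
    fun g hg => by
      rw [RatFunc.inftyValuation_apply, RatFunc.inftyValuation_of_nonzero k hg, WithZero.log_exp]
  rw [← h1 _ (zpow_ne_zero _ hf), ← h1 _ hf, map_zpow₀, WithZero.log_zpow, smul_eq_mul]

lemma intDegree_prod {ι : Type*} (s : Finset ι) (f : ι → RatFunc k) (hf : ∀ i ∈ s, f i ≠ 0) :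
    (∏ i ∈ s, f i).intDegree = ∑ i ∈ s, (f i).intDegree := by
  classical
  induction s using Finset.induction_on with
  | empty => simp
  | insert a s ha ih =>
    rw [Finset.prod_insert ha, Finset.sum_insert ha, RatFunc.intDegree_mul
      (hf a (Finset.mem_insert_self a s))
      (Finset.prod_ne_zero_iff.mpr fun i hi => hf i (Finset.mem_insert_of_mem hi)),
      ih fun i hi => hf i (Finset.mem_insert_of_mem hi)]

lemma intDegree_primeProd (n : ℕ) {u : k} (hu : u ≠ 0) (e : ℕ → ℤ) :
    (RatFunc.C u * primeProd P n e).intDegree =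
      ∑ i ∈ Finset.Icc 1 n, e i * ((P i).1.natDegree : ℤ) := by
  rw [RatFunc.intDegree_mul (ratFuncC_ne_zero hu) (primeProd_ne_zero P n e), RatFunc.intDegree_C,
    zero_add, primeProd, intDegree_prod _ _ fun i _ => poly_zpow_ne_zero P i _]
  refine Finset.sum_congr rfl fun i _ => ?_
  rw [intDegree_zpow (algebraMap_poly_ne_zero (P i).2.2.ne_zero), RatFunc.intDegree_polynomial]

variable {s r n : ℕ} {S : Set (Place k (RatFunc k))}

lemma IsIndexing.injOn (h : IsIndexing P s r n S) : Set.InjOn P (Set.Icc 1 n) := by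
  intro i hi j hj hij
  exact h.bij.injOn hi hj (by simp only [hij])

lemma IsIndexing.intDegree_radicand (h : IsIndexing P s r n S) {u : k} (hu : u ≠ 0) (ε : ℕ → ℤ) :
    (radicand P s r n u ε).intDegree ≡ ∑ i ∈ Finset.Icc (s + 1) n, ε i [ZMOD 3] := by
  have h1 : Finset.Icc 1 n = Finset.Icc 1 s ∪ Finset.Icc (s + 1) n := by
    have := h.le_r; have := h.le_n
    ext i; simp only [Finset.mem_Icc, Finset.mem_union]; omega
  rw [radicand_eq P h.le_r h.le_n, intDegree_primeProd n hu, h1, Finset.sum_union (by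
    rw [Finset.disjoint_left]; intro i; simp only [Finset.mem_Icc]; omega)]
  have h2 : ∑ i ∈ Finset.Icc 1 s, orient s r i * ε i * ((P i).1.natDegree : ℤ) ≡ 0 [ZMOD 3] := by
    rw [Int.modEq_zero_iff_dvd]
    exact Finset.dvd_sum fun i hi =>
      Dvd.dvd.mul_left (Int.modEq_zero_iff_dvd.mp (h.deg_zero i hi)) _
  have h3 : ∑ i ∈ Finset.Icc (s + 1) n, orient s r i * ε i * ((P i).1.natDegree : ℤ) ≡
      ∑ i ∈ Finset.Icc (s + 1) n, ε i [ZMOD 3] := by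
    refine Int.ModEq.sum fun i hi => ?_
    rw [Finset.mem_Icc] at hi
    rcases le_or_gt i r with hir | hir
    · rw [orient, if_pos ⟨hi.1, hir⟩]
      refine (Int.ModEq.mul_left _ (h.deg_neg_one i (Finset.mem_Icc.mpr ⟨hi.1, hir⟩))).trans ?_
      ring_nf; rfl
    · rw [orient, if_neg (by omega)]
      refine (Int.ModEq.mul_left _ (h.deg_one i (Finset.mem_Icc.mpr ⟨hir, hi.2⟩))).trans ?_
      ring_nf; rfl
  simpa using h2.add h3

lemma radicand_ne_zero (h : IsIndexing P s r n S) {u : k} (hu : u ≠ 0) (ε : ℕ → ℤ) :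
    radicand P s r n u ε ≠ 0 := by
  rw [radicand_eq P h.le_r h.le_n]
  exact mul_ne_zero (ratFuncC_ne_zero hu) (primeProd_ne_zero P n _)

variable {L : Type*} [Field L] [Algebra (RatFunc k) L]

/-- The fully ramified places of the cubic extension given by a radicand. -/
theorem IsIndexing.mem_fullyRamifiedPlaces_iff (h : IsIndexing P s r n S) (h3 : (3 : k) ≠ 0)
    (hdeg : Module.finrank (RatFunc k) L = 3) {y : L} (hgen : (RatFunc k)⟮y⟯ = ⊤)
    {u : k} (hu : u ≠ 0) {ε : ℕ → ℤ} (hε : ∀ i ∈ Finset.Icc 1 n, ε i = 1 ∨ ε i = -1)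
    (hy : y ^ 3 = algebraMap (RatFunc k) L (radicand P s r n u ε)) (p : Place k (RatFunc k)) :
    p ∈ fullyRamifiedPlaces k (RatFunc k) L ↔ p ∈ S ∨
      (p = inftyPlace k ∧ ¬ ∑ i ∈ Finset.Icc (s + 1) n, ε i ≡ 0 [ZMOD 3]) := by
  have hβ := radicand_ne_zero h hu ε
  rcases eq_inftyPlace_or_exists_finitePlace p with rfl | ⟨Q, hQm, hQ, rfl⟩
  · have hS : inftyPlace k ∉ S := fun hm => by
      obtain ⟨i, _, hi⟩ := h.bij.surjOn hm
      exact finitePlace_ne_inftyPlace _ hi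
    rw [inftyPlace_mem_fullyRamifiedPlaces_iff h3 hdeg hgen hβ hy, ← Int.modEq_zero_iff_dvd]
    simp only [hS, false_or, true_and]
    have hd := h.intDegree_radicand hu ε
    exact not_congr ⟨fun h' => hd.symm.trans h', fun h' => hd.trans h'⟩
  · rw [finitePlace_mem_fullyRamifiedPlaces_iff h3 hdeg hgen hβ hy hQ]
    simp only [finitePlace_ne_inftyPlace, false_and, or_false]
    rw [radicand_eq P h.le_r h.le_n]
    by_cases hi : ∃ i ∈ Finset.Icc 1 n, Q = (P i).1
    · obtain ⟨i, hi, rfl⟩ := hi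
      rw [ordAt_primeProd h.injOn hu _ hi]
      refine iff_of_true ?_ (h.bij.mapsTo (by simpa using hi))
      rcases hε i hi with h1 | h1 <;> rcases orient_eq_or s r i with h2 | h2 <;> rw [h1, h2] <;>
        norm_num
    · push Not at hi
      rw [ordAt_primeProd_of_ne hQm hQ hu _ hi]
      refine iff_of_false (by simp) fun hm => ?_
      obtain ⟨i, hiI, hi'⟩ := h.bij.surjOn hm
      exact hi i (by simpa using hiI) (finitePlace_injective _ (P i).2.1 hQm hQ hi').symm

/-- Reduction of the radicand modulo cubes: only the exponents modulo three matter, and the first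
sign is normalized by passing to `y⁻¹`. -/
theorem IsIndexing.exists_generator (h : IsIndexing P s r n S) (h3 : (3 : k) ≠ 0)
    (hdeg : Module.finrank (RatFunc k) L = 3) {y : L} (hgen : (RatFunc k)⟮y⟯ = ⊤)
    {β : RatFunc k} (hβ : β ≠ 0) (hy : y ^ 3 = algebraMap (RatFunc k) L β)
    (hS : fullyRamifiedPlaces k (RatFunc k) L \ {inftyPlace k} = S) :
    ∃ (y : L) (u : k) (ε : ℕ → ℤ), (RatFunc k)⟮y⟯ = ⊤ ∧ u ≠ 0 ∧ ε 1 = 1 ∧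
      (∀ i ∈ Finset.Icc 1 n, ε i = 1 ∨ ε i = -1) ∧
      y ^ 3 = algebraMap (RatFunc k) L (radicand P s r n u ε) := by
  set o : ℕ → ℤ := fun i => ordAt (P i).1 (P i).2.2 β with ho
  -- for `1 ≤ i ≤ n`, `o i` is not divisible by three and `e i` is its residue `± 1`
  set e : ℕ → ℤ := fun i => if o i % 3 = 1 then 1 else -1 with he
  have he1 : ∀ i, e i = 1 ∨ e i = -1 := fun i => by simp only [he]; split_ifs <;> simp
  have hP0 := primeProd_ne_zero P n e
  have h1 : ∀ (Q : k[X]) (_ : Q.Monic) (hQ : Irreducible Q),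
      (3 : ℤ) ∣ ordAt Q hQ (β * (primeProd P n e)⁻¹) := by
    intro Q hQm hQ
    have h2 : ordAt Q hQ (β * (primeProd P n e)⁻¹) =
        ordAt Q hQ β - ordAt Q hQ (RatFunc.C 1 * primeProd P n e) := by
      rw [ordAt_mul hQ hβ (inv_ne_zero hP0), ← zpow_neg_one, ordAt_zpow, map_one, one_mul]
      ring
    rw [h2]
    have hram := finitePlace_mem_fullyRamifiedPlaces_iff h3 hdeg hgen hβ hy hQ
    have hS' : finitePlace Q hQ ∈ fullyRamifiedPlaces k (RatFunc k) L ↔ finitePlace Q hQ ∈ S := by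
      rw [← hS]
      simp [finitePlace_ne_inftyPlace]
    rw [hS'] at hram
    by_cases hi : ∃ i ∈ Finset.Icc 1 n, Q = (P i).1
    · obtain ⟨i, hi, rfl⟩ := hi
      rw [ordAt_primeProd h.injOn one_ne_zero _ hi]
      have h4 := hram.mp (h.bij.mapsTo (by simpa using hi))
      change ¬ 3 ∣ o i at h4
      change 3 ∣ o i - e i
      simp only [he]
      split_ifs <;> omega
    · push Not at hi
      rw [ordAt_primeProd_of_ne hQm hQ one_ne_zero _ hi, sub_zero]
      by_contra hcon
      obtain ⟨i, hiI, hi'⟩ := h.bij.surjOn (hram.mpr hcon)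
      exact hi i (by simpa using hiI) (finitePlace_injective _ (P i).2.1 hQm hQ hi').symm
  obtain ⟨u, c, hu, hc, hβc⟩ := exists_eq_C_mul_pow_three (mul_ne_zero hβ (inv_ne_zero hP0)) h1
  rw [← div_eq_mul_inv, div_eq_iff hP0] at hβc
  have hcL : algebraMap (RatFunc k) L c ≠ 0 := by simpa using hc
  have hgen' : (RatFunc k)⟮y / algebraMap (RatFunc k) L c⟯ = ⊤ := by
    rw [eq_top_iff, ← hgen, IntermediateField.adjoin_simple_le_iff]
    have h1 := mul_mem (IntermediateField.mem_adjoin_simple_self (RatFunc k)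
        (y / algebraMap (RatFunc k) L c))
      (IntermediateField.algebraMap_mem (RatFunc k)⟮y / algebraMap (RatFunc k) L c⟯ c)
    rwa [div_mul_cancel₀ _ hcL] at h1
  have hy' : (y / algebraMap (RatFunc k) L c) ^ 3 =
      algebraMap (RatFunc k) L (RatFunc.C u * primeProd P n e) := by
    rw [div_pow, hy, hβc, ← map_pow, ← map_div₀]
    congr 1
    field_simp
  -- the exponents are determined up to a common sign, since `y⁻¹` is a generator as well
  rcases eq_or_ne (orient s r 1 * e 1) 1 with h5 | h5
  · refine ⟨_, u, fun i => orient s r i * e i, hgen', hu, h5, fun i _ => ?_, ?_⟩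
    · rcases orient_eq_or s r i with h2 | h2 <;> rcases he1 i with h6 | h6 <;>
        simp only [h2, h6] <;> norm_num
    · rw [radicand_eq P h.le_r h.le_n, hy']
      simp only [← mul_assoc, orient_mul_self, one_mul]
  · refine ⟨(y / algebraMap (RatFunc k) L c)⁻¹, u⁻¹, fun i => -(orient s r i * e i), ?_,
      inv_ne_zero hu, ?_, fun i _ => ?_, ?_⟩
    · rw [eq_top_iff, ← hgen', IntermediateField.adjoin_simple_le_iff]
      have h1 := inv_mem (IntermediateField.mem_adjoin_simple_self (RatFunc k)
        (y / algebraMap (RatFunc k) L c)⁻¹)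
      rwa [inv_inv] at h1
    · change -(orient s r 1 * e 1) = 1
      rcases orient_eq_or s r 1 with h2 | h2 <;> rcases he1 1 with h6 | h6 <;>
        rw [h2, h6] at h5 ⊢ <;> omega
    · rcases orient_eq_or s r i with h2 | h2 <;> rcases he1 i with h6 | h6 <;>
        simp only [h2, h6] <;> norm_num
    · rw [radicand_eq P h.le_r h.le_n, inv_pow, hy', ← map_inv₀, mul_inv]
      simp only [mul_neg, ← mul_assoc, orient_mul_self, one_mul, primeProd_neg, map_inv₀]

end Radicand

/-! ### Existence of covers -/

section Constants

lemma valuation_eq_one_of_isIntegral {k L : Type*} [Field k] [Field L] [Algebra k L]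
    (O : ValuationSubring L) (hk : ∀ c : k, algebraMap k L c ∈ O) {z : L} (hz : z ≠ 0)
    (hint : IsIntegral k z) : O.valuation z = 1 := by
  have hmem : ∀ w : L, IsIntegral k w → O.valuation w ≤ 1 := by
    rintro w ⟨p, hp, hpw⟩
    rw [ValuationSubring.valuation_le_one_iff]
    let f : k →+* O := (algebraMap k L).codRestrict O.toSubring hk
    have hw : IsIntegral O w := ⟨p.map f, hp.map f, by rw [Polynomial.eval₂_map]; exact hpw⟩
    obtain ⟨a, rfl⟩ := IsIntegrallyClosed.isIntegral_iff.mp hw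
    exact a.2
  refine le_antisymm (hmem z hint) ?_
  have h1 := hmem z⁻¹ hint.inv
  rwa [map_inv₀, inv_le_one₀ (by simpa [zero_lt_iff] using hz)] at h1

/-- Constant cubic extensions are unramified, so a cubic extension with a fully ramified place is
geometric. -/
theorem not_exists_constant_extension {k K L : Type*} [Field k] [PerfectField k] [Field K] [Field L]
    [Algebra k K] [Algebra k L] [Algebra K L] [IsScalarTower k K L]
    {v : Valuation K (WithZero (Multiplicative ℤ))} {π : K} (hπ : v π = WithZero.exp (-1))
    (hdeg : Module.finrank K L = 3) (p : Place k K) (hp : p.1 = v.valuationSubring)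
    (hram : p ∈ fullyRamifiedPlaces k K L) :
    ¬ ∃ ℓ : IntermediateField k L, Module.finrank k ℓ = 3 ∧
      IntermediateField.adjoin K (ℓ : Set L) = ⊤ := by
  rintro ⟨ℓ, hℓ, htop⟩
  obtain ⟨O', hO', hram⟩ := hram
  have := FiniteDimensional.of_finrank_eq_succ hℓ
  obtain ⟨θ, hθ⟩ := Field.exists_primitive_element k ℓ
  have hgen : K⟮(θ : L)⟯ = ⊤ := by
    rw [eq_top_iff, ← htop, IntermediateField.adjoin_le_iff]
    intro z hz
    obtain ⟨q, hq⟩ := exists_aeval_eq_of_adjoin_eq_top hθ ⟨z, hz⟩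
    have hq' : Polynomial.aeval (θ : L) q = z := by
      have := congrArg (algebraMap ℓ L) hq
      change algebraMap ℓ L (Polynomial.aeval θ q) = z at this
      rwa [← Polynomial.aeval_algebraMap_apply] at this
    rw [← hq', ← Polynomial.aeval_map_algebraMap K]
    exact IntermediateField.algebra_adjoin_le_adjoin K {(θ : L)}
      (Polynomial.aeval_mem_adjoin_singleton K (θ : L))
  have hkO : ∀ c : k, algebraMap k K c ∈ v.valuationSubring := fun c => hp ▸ p.2.1 c
  have hkO' : ∀ c : k, algebraMap k L c ∈ O' := fun c => by
    rw [IsScalarTower.algebraMap_apply k K L, ← ValuationSubring.mem_comap, hO', hp]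
    exact hkO c
  let f : k →+* v.valuationSubring :=
    (algebraMap k K).codRestrict v.valuationSubring.toSubring hkO
  have hf : ((algebraMap K L).comp v.valuationSubring.subtype).comp f = algebraMap k L :=
    (IsScalarTower.algebraMap_eq k K L).symm
  have hev : ∀ q : k[X], (q.map f).eval₂ ((algebraMap K L).comp v.valuationSubring.subtype) (θ : L)
      = algebraMap ℓ L (Polynomial.aeval θ q) := by
    intro q
    rw [Polynomial.eval₂_map, hf, ← Polynomial.aeval_algebraMap_apply]
    rfl
  have hone : ∀ z : ℓ, z ≠ 0 → O'.valuation (algebraMap ℓ L z) = 1 := fun z hz =>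
    valuation_eq_one_of_isIntegral O' hkO' (by simpa using hz)
      ((Algebra.IsIntegral.isIntegral z).map (IsScalarTower.toAlgHom k ℓ L))
  have hθ1 : O'.valuation (θ : L) ≤ 1 := by
    rcases eq_or_ne θ 0 with h0 | h0
    · simp [h0]
    · exact (hone θ h0).le
  have h1 := unitGroup_sup_range_eq_top (hO'.trans hp) hπ hdeg hgen ((minpoly k θ).map f) hθ1
    (by rw [hev, minpoly.aeval, map_zero])
    (by
      rw [Polynomial.derivative_map, hev]
      exact hone _ ((Algebra.IsSeparable.isSeparable k θ).aeval_derivative_ne_zero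
        (minpoly.aeval k θ)))
  rw [ramificationIndex, h1, Subgroup.index_top, hdeg] at hram
  omega

end Constants

section Existence

lemma isSeparable_of_pow_three {K L : Type*} [Field K] [Field L] [Algebra K L] (h3 : (3 : K) ≠ 0)
    {y : L} (hgen : K⟮y⟯ = ⊤) {β : K} (hβ : β ≠ 0)
    (hmin : minpoly K y = Polynomial.X ^ 3 - Polynomial.C β) :
    Algebra.IsSeparable K L := by
  have h1 : IsSeparable K y := by
    rw [IsSeparable, hmin]
    exact Polynomial.separable_X_pow_sub_C β (by exact_mod_cast h3) hβ
  have h2 := IntermediateField.isSeparable_adjoin_simple_iff_isSeparable K L |>.mpr h1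
  rw [hgen] at h2
  exact AlgEquiv.Algebra.isSeparable IntermediateField.topEquiv

variable {k : Type u} [Field k] {P : ℕ → {p : k[X] // p.Monic ∧ Irreducible p}} {s r n : ℕ}
  {S : Set (Place k (RatFunc k))}

lemma IsIndexing.pow_three_ne_radicand (h : IsIndexing P s r n S) (hn : 1 ≤ n) {u : k} (hu : u ≠ 0)
    {ε : ℕ → ℤ} (hε : ∀ i ∈ Finset.Icc 1 n, ε i = 1 ∨ ε i = -1) (b : RatFunc k) :
    b ^ 3 ≠ radicand P s r n u ε := by
  intro hb
  have h1 := congrArg (ordAt (P 1).1 (P 1).2.2) hb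
  have hm : 1 ∈ Finset.Icc 1 n := by simp [hn]
  rw [radicand_eq P h.le_r h.le_n, ordAt_pow, ordAt_primeProd h.injOn hu _ hm] at h1
  rcases hε 1 hm with h2 | h2 <;> rcases orient_eq_or s r 1 with h3 | h3 <;>
    rw [h2, h3] at h1 <;> omega

/-- Every choice of signs with the right sum is realized by a cover. -/
theorem IsIndexing.exists_cover [PerfectField k] (h3 : (3 : k) ≠ 0) {T : Set (Place k (RatFunc k))}
    (h : IsIndexing P s r n (T \ {inftyPlace k})) (hn : 1 ≤ n)
    {ε : ℕ → ℤ} (hε : ∀ i ∈ Finset.Icc 1 n, ε i = 1 ∨ ε i = -1)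
    (hT : inftyPlace k ∈ T ↔ ¬ ∑ i ∈ Finset.Icc (s + 1) n, ε i ≡ 0 [ZMOD 3]) :
    ∃ (C : Cover k T) (y : C.carrier), (RatFunc k)⟮y⟯ = ⊤ ∧
      y ^ 3 = algebraMap (RatFunc k) C.carrier (radicand P s r n 1 ε) := by
  set D := radicand P s r n 1 ε with hD
  have hD0 : D ≠ 0 := radicand_ne_zero h one_ne_zero ε
  set f : (RatFunc k)[X] := Polynomial.X ^ 3 - Polynomial.C D with hf
  have hirr : Irreducible f := X_pow_sub_C_irreducible_of_prime Nat.prime_three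
    (h.pow_three_ne_radicand hn one_ne_zero hε)
  have hmon : f.Monic := Polynomial.monic_X_pow_sub_C D (by norm_num)
  have : Fact (Irreducible f) := ⟨hirr⟩
  have hroot : AdjoinRoot.root f ^ 3 = algebraMap (RatFunc k) (AdjoinRoot f) D := by
    have h1 := AdjoinRoot.eval₂_root f
    rw [hf, Polynomial.eval₂_sub, Polynomial.eval₂_pow, Polynomial.eval₂_X,
      Polynomial.eval₂_C] at h1
    exact sub_eq_zero.mp h1
  have hmin : minpoly (RatFunc k) (AdjoinRoot.root f) = f := by
    rw [AdjoinRoot.minpoly_root hirr.ne_zero, hmon.leadingCoeff, inv_one, map_one, mul_one]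
  have hgen : (RatFunc k)⟮AdjoinRoot.root f⟯ = ⊤ := IntermediateField.adjoin_root_eq_top f
  have hdeg : Module.finrank (RatFunc k) (AdjoinRoot f) = 3 := by
    rw [(AdjoinRoot.powerBasis hirr.ne_zero).finrank, AdjoinRoot.powerBasis_dim, hf,
      Polynomial.natDegree_X_pow_sub_C]
  have hram := h.mem_fullyRamifiedPlaces_iff h3 hdeg hgen one_ne_zero hε hroot
  have hm : 1 ∈ Set.Icc 1 n := by simp [hn]
  have h3' : (3 : RatFunc k) ≠ 0 := by
    rw [← map_ofNat RatFunc.C 3]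
    exact ratFuncC_ne_zero h3
  refine ⟨{ carrier := AdjoinRoot f
            purelyCubic := ⟨⟨isSeparable_of_pow_three h3' hgen hD0 hmin, hdeg,
              not_exists_constant_extension (valuation_self (P 1).2.2) hdeg
                (finitePlace (P 1).1 (P 1).2.2) rfl
                ((hram _).mpr (Or.inl (h.bij.mapsTo hm)))⟩, AdjoinRoot.root f, D, hgen, hmin⟩
            ramified := ?_ }, AdjoinRoot.root f, hgen, hroot⟩
  ext p
  rw [hram, ← hT]
  by_cases hp : p = inftyPlace k
  · simp [hp]
  · simp [hp]

end Existence

/-! ### Isomorphism over the algebraic closure -/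

section Kummer

/-- The part of Kummer theory used below, valid without roots of unity: an element
`a + b z + c z ^ 2` whose cube lies in `M` is a monomial in `z`. -/
lemma cube_classes_of_mem_adjoin {M F : Type*} [Field M] [Field F] [Algebra M F] (h3 : (3 : M) ≠ 0)
    {D E : M} {z w : F} (hz : z ^ 3 = algebraMap M F D) (hw : w ^ 3 = algebraMap M F E)
    (hmem : w ∈ Algebra.adjoin M {z}) (hD : ∀ b : M, b ^ 3 ≠ D) :
    ∃ b : M, E = b ^ 3 ∨ E = b ^ 3 * D ∨ E = b ^ 3 * D ^ 2 := by
  have hirr : Irreducible (Polynomial.X ^ 3 - Polynomial.C D : M[X]) :=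
    X_pow_sub_C_irreducible_of_prime Nat.prime_three hD
  have hmin : minpoly M z = Polynomial.X ^ 3 - Polynomial.C D :=
    (minpoly.eq_of_irreducible_of_monic hirr (by simp [hz])
      (Polynomial.monic_X_pow_sub_C D (by norm_num))).symm
  have hli : ∀ p q r : M,
      algebraMap M F p + algebraMap M F q * z + algebraMap M F r * z ^ 2 = 0 →
        p = 0 ∧ q = 0 ∧ r = 0 := by
    intro p q r h
    set f : M[X] := Polynomial.C r * Polynomial.X ^ 2 + Polynomial.C q * Polynomial.X
      + Polynomial.C p with hf
    have hdvd : minpoly M z ∣ f := by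
      rw [minpoly.dvd_iff]
      simp only [hf, map_add, map_mul, map_pow, Polynomial.aeval_C, Polynomial.aeval_X]
      linear_combination h
    have hf0 : f = 0 := by
      by_contra hne
      have h1 := Polynomial.natDegree_le_of_dvd hdvd hne
      rw [hmin, Polynomial.natDegree_X_pow_sub_C] at h1
      have h2 : f.natDegree ≤ 2 := Polynomial.natDegree_quadratic_le
      omega
    have c0 := congrArg (fun g => Polynomial.coeff g 0) hf0
    have c1 := congrArg (fun g => Polynomial.coeff g 1) hf0
    have c2 := congrArg (fun g => Polynomial.coeff g 2) hf0
    simp [hf, Polynomial.coeff_X, Polynomial.coeff_C] at c0 c1 c2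
    exact ⟨c0, c1, c2⟩
  obtain ⟨a, b, c, rfl⟩ := exists_eq_quadratic_of_pow_three hz hmem
  obtain ⟨e0, e1, e2⟩ := hli (a ^ 3 + b ^ 3 * D + c ^ 3 * D ^ 2 + 6 * a * b * c * D - E)
    (3 * (a ^ 2 * b + a * c ^ 2 * D + b ^ 2 * c * D))
    (3 * (a ^ 2 * c + a * b ^ 2 + b * c ^ 2 * D)) (by
      simp only [map_add, map_sub, map_mul, map_pow, map_ofNat]
      rw [← hw, ← hz]; ring)
  replace e1 := (mul_eq_zero.mp e1).resolve_left h3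
  replace e2 := (mul_eq_zero.mp e2).resolve_left h3
  have hD0 : D ≠ 0 := fun h => hD 0 (by rw [h]; ring)
  by_cases ha : a = 0
  · subst ha
    have : b = 0 ∨ c = 0 := by simpa [hD0] using e1
    rcases this with rfl | rfl
    · exact ⟨c, Or.inr (Or.inr (by linear_combination -e0))⟩
    · exact ⟨b, Or.inr (Or.inl (by linear_combination -e0))⟩
  by_cases hb : b = 0
  · subst hb
    have : c = 0 := by simpa [ha] using e2
    subst this
    exact ⟨a, Or.inl (by linear_combination -e0)⟩
  by_cases hc : c = 0
  · subst hc
    exact absurd e1 (by simp [ha, hb])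
  -- eliminating the common terms exhibits `D` as a cube
  exfalso
  have h1 : a * (c ^ 3 * D - b ^ 3) = 0 := by linear_combination c * e1 - b * e2
  have h2 := (mul_eq_zero.mp h1).resolve_left ha
  exact hD (b / c) (by rw [div_pow]; field_simp; linear_combination -h2)

end Kummer

section Lift

variable {K L : Type*} [Field K] [Field L] [Algebra K L] {y : L}

lemma ringHom_ext_of_adjoin_eq_top (hdeg : Module.finrank K L = 3) (hgen : K⟮y⟯ = ⊤) {B : Type*}
    [CommRing B] {f g : L →+* B} (hK : ∀ a : K, f (algebraMap K L a) = g (algebraMap K L a))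
    (hy : f y = g y) : f = g := by
  have := FiniteDimensional.of_finrank_eq_succ hdeg
  ext z
  obtain ⟨q, rfl⟩ := exists_aeval_eq_of_adjoin_eq_top hgen z
  rw [Polynomial.aeval_def, Polynomial.hom_eval₂, Polynomial.hom_eval₂, hy]
  congr 1
  ext a
  exact hK a

lemma minpoly_eq_of_pow_three (hdeg : Module.finrank K L = 3) (hgen : K⟮y⟯ = ⊤) {β : K}
    (hy : y ^ 3 = algebraMap K L β) : minpoly K y = Polynomial.X ^ 3 - Polynomial.C β := by
  have := FiniteDimensional.of_finrank_eq_succ hdeg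
  have hint : IsIntegral K y := Algebra.IsIntegral.isIntegral y
  refine Eq.symm <| Polynomial.eq_of_monic_of_dvd_of_natDegree_le (minpoly.monic hint)
    (Polynomial.monic_X_pow_sub_C β (by norm_num)) (minpoly.dvd K y (by simp [hy])) ?_
  rw [Polynomial.natDegree_X_pow_sub_C, ← IntermediateField.adjoin.finrank hint, hgen,
    IntermediateField.finrank_top', hdeg]

lemma exists_ringHom_of_pow_three (hdeg : Module.finrank K L = 3) (hgen : K⟮y⟯ = ⊤) {β : K}
    (hy : y ^ 3 = algebraMap K L β) {B : Type*} [CommRing B] (φ : K →+* B) {b : B}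
    (hb : b ^ 3 = φ β) :
    ∃ ψ : L →+* B, (∀ a, ψ (algebraMap K L a) = φ a) ∧ ψ y = b := by
  have := FiniteDimensional.of_finrank_eq_succ hdeg
  have hint : IsIntegral K y := Algebra.IsIntegral.isIntegral y
  let := φ.toAlgebra
  let pb : PowerBasis K L := PowerBasis.ofAdjoinEqTop hint (by
    rw [← IntermediateField.adjoin_simple_toSubalgebra_of_isAlgebraic hint.isAlgebraic, hgen]
    rfl)
  have hpb : pb.gen = y := PowerBasis.ofAdjoinEqTop_gen _ _
  have hroot : Polynomial.aeval b (minpoly K pb.gen) = 0 := by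
    rw [hpb, minpoly_eq_of_pow_three hdeg hgen hy]
    simp only [map_sub, map_pow, Polynomial.aeval_X, Polynomial.aeval_C, hb]
    exact sub_self _
  refine ⟨(pb.lift b hroot).toRingHom, fun a => (pb.lift b hroot).commutes a, ?_⟩
  change pb.lift b hroot y = b
  conv_lhs => rw [← hpb]
  exact pb.lift_gen b hroot

end Lift

section Twist

lemma tmul_eq_smul_one_tmul {k A B : Type*} [CommRing k] [CommRing A] [CommRing B] [Algebra k A]
    [Algebra k B] (a : A) (b : B) : a ⊗ₜ[k] b = a • ((1 : A) ⊗ₜ[k] b) := by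
  rw [TensorProduct.smul_tmul', smul_eq_mul, mul_one]

variable {k K L₁ L₂ : Type*} [Field k] [Field K] [Field L₁] [Field L₂] [Algebra k K] [Algebra k L₁]
  [Algebra k L₂] [Algebra K L₁] [Algebra K L₂] [IsScalarTower k K L₁] [IsScalarTower k K L₂]

lemma exists_algHom_baseChange (hdeg : Module.finrank K L₁ = 3) {y₁ : L₁} {y₂ : L₂}
    (hgen : K⟮y₁⟯ = ⊤) {β : K} {u₁ u₂ : k} (hu₂ : u₂ ≠ 0)
    (hy₁ : y₁ ^ 3 = algebraMap K L₁ (algebraMap k K u₁ * β))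
    (hy₂ : y₂ ^ 3 = algebraMap K L₂ (algebraMap k K u₂ * β))
    {c : AlgebraicClosure k} (hc : c ^ 3 = algebraMap k _ (u₁ / u₂)) :
    ∃ Φ : (AlgebraicClosure k ⊗[k] L₁) →ₐ[AlgebraicClosure k] (AlgebraicClosure k ⊗[k] L₂),
      (∀ f : K, Φ (1 ⊗ₜ algebraMap K L₁ f) = 1 ⊗ₜ algebraMap K L₂ f) ∧
        Φ (1 ⊗ₜ y₁) = c ⊗ₜ y₂ := by
  obtain ⟨ψ, hψ, hψy⟩ := exists_ringHom_of_pow_three hdeg hgen hy₁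
    ((Algebra.TensorProduct.includeRight : L₂ →ₐ[k] AlgebraicClosure k ⊗[k] L₂).toRingHom.comp
      (algebraMap K L₂)) (b := c ⊗ₜ y₂) (by
      rw [Algebra.TensorProduct.tmul_pow, hc, hy₂, Algebra.algebraMap_eq_smul_one,
        TensorProduct.smul_tmul, Algebra.smul_def, IsScalarTower.algebraMap_apply k K L₂, ← map_mul,
        ← mul_assoc, ← map_mul, div_mul_cancel₀ _ hu₂]
      rfl)
  let ψ' : L₁ →ₐ[k] AlgebraicClosure k ⊗[k] L₂ :=
    { ψ with
      commutes' := fun a => by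
        change ψ (algebraMap k L₁ a) = _
        rw [IsScalarTower.algebraMap_apply k K L₁, hψ]
        change (1 : AlgebraicClosure k) ⊗ₜ[k] algebraMap K L₂ (algebraMap k K a) = _
        rw [← IsScalarTower.algebraMap_apply k K L₂, Algebra.TensorProduct.algebraMap_apply,
          Algebra.algebraMap_eq_smul_one, Algebra.algebraMap_eq_smul_one, TensorProduct.smul_tmul] }
  refine ⟨Algebra.TensorProduct.lift (Algebra.ofId _ _) ψ' fun _ _ => Commute.all _ _,
    fun f => ?_, ?_⟩
  · rw [Algebra.TensorProduct.lift_tmul, map_one, one_mul]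
    exact hψ f
  · rw [Algebra.TensorProduct.lift_tmul, map_one, one_mul]
    exact hψy

/-- Constant factors of the radicand become cubes over the algebraic closure. -/
theorem geomIsomorphic_of_pow_three (hdeg₁ : Module.finrank K L₁ = 3)
    (hdeg₂ : Module.finrank K L₂ = 3) {y₁ : L₁} {y₂ : L₂}
    (hgen₁ : K⟮y₁⟯ = ⊤) (hgen₂ : K⟮y₂⟯ = ⊤) {β : K} {u₁ u₂ : k} (hu₁ : u₁ ≠ 0) (hu₂ : u₂ ≠ 0)
    (hy₁ : y₁ ^ 3 = algebraMap K L₁ (algebraMap k K u₁ * β))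
    (hy₂ : y₂ ^ 3 = algebraMap K L₂ (algebraMap k K u₂ * β)) :
    GeomIsomorphic k K L₁ L₂ := by
  obtain ⟨c, hc⟩ := IsAlgClosed.exists_pow_nat_eq
    (algebraMap k (AlgebraicClosure k) (u₁ / u₂)) (n := 3) (by norm_num)
  have hc' : c⁻¹ ^ 3 = algebraMap k (AlgebraicClosure k) (u₂ / u₁) := by
    rw [inv_pow, hc, ← map_inv₀, inv_div]
  have hc0 : c ≠ 0 := by
    rintro rfl
    rw [zero_pow (by norm_num), eq_comm, map_eq_zero] at hc
    exact div_ne_zero hu₁ hu₂ hc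
  obtain ⟨Φ, hΦ, hΦy⟩ := exists_algHom_baseChange hdeg₁ hgen₁ hu₂ hy₁ hy₂ hc
  obtain ⟨Ψ, hΨ, hΨy⟩ := exists_algHom_baseChange hdeg₂ hgen₂ hu₁ hy₂ hy₁ hc'
  refine ⟨AlgEquiv.ofAlgHom Φ Ψ ?_ ?_, hΦ⟩
  · refine Algebra.TensorProduct.ext (Subsingleton.elim _ _) (AlgHom.coe_ringHom_injective ?_)
    refine ringHom_ext_of_adjoin_eq_top hdeg₂ hgen₂ (fun a => ?_) ?_
    · change Φ (Ψ (1 ⊗ₜ algebraMap K L₂ a)) = 1 ⊗ₜ algebraMap K L₂ a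
      rw [hΨ, hΦ]
    · change Φ (Ψ (1 ⊗ₜ y₂)) = 1 ⊗ₜ y₂
      rw [hΨy, tmul_eq_smul_one_tmul, map_smul, hΦy, tmul_eq_smul_one_tmul c, smul_smul,
        inv_mul_cancel₀ hc0, one_smul]
  · refine Algebra.TensorProduct.ext (Subsingleton.elim _ _) (AlgHom.coe_ringHom_injective ?_)
    refine ringHom_ext_of_adjoin_eq_top hdeg₁ hgen₁ (fun a => ?_) ?_
    · change Ψ (Φ (1 ⊗ₜ algebraMap K L₁ a)) = 1 ⊗ₜ algebraMap K L₁ a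
      rw [hΦ, hΨ]
    · change Ψ (Φ (1 ⊗ₜ y₁)) = 1 ⊗ₜ y₁
      rw [hΦy, tmul_eq_smul_one_tmul, map_smul, hΨy, tmul_eq_smul_one_tmul c⁻¹, smul_smul,
        mul_inv_cancel₀ hc0, one_smul]

end Twist

section Geometric

variable (k : Type*) [Field k]

/-- The inclusion of `k(x)` in `k̄(x)`. -/
def geomMap : RatFunc k →+* RatFunc (AlgebraicClosure k) :=
  RatFunc.mapRingHom (Polynomial.mapRingHom (algebraMap k (AlgebraicClosure k)))
    (nonZeroDivisors_le_comap_nonZeroDivisors_of_injective _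
      (Polynomial.map_injective _ (algebraMap k (AlgebraicClosure k)).injective))

variable {k}

lemma geomMap_algebraMap (f : k[X]) : geomMap k (algebraMap k[X] (RatFunc k) f) =
    algebraMap (AlgebraicClosure k)[X] _ (f.map (algebraMap k (AlgebraicClosure k))) := by
  have h := RatFunc.map_apply_div (Polynomial.mapRingHom (algebraMap k (AlgebraicClosure k)))
    (nonZeroDivisors_le_comap_nonZeroDivisors_of_injective _
      (Polynomial.map_injective _ (algebraMap k (AlgebraicClosure k)).injective)) f 1
  simp only [map_one, div_one] at h
  exact h

lemma geomMap_C (c : k) :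
    geomMap k (RatFunc.C c) = RatFunc.C (algebraMap k (AlgebraicClosure k) c) := by
  rw [← RatFunc.algebraMap_C, geomMap_algebraMap, Polynomial.map_C, RatFunc.algebraMap_C]

variable {L₁ L₂ : Type*} [Field L₁] [Field L₂] [Algebra k L₁] [Algebra k L₂]
  [Algebra (RatFunc k) L₁] [Algebra (RatFunc k) L₂] [IsScalarTower k (RatFunc k) L₂]

/-- If two pure cubic extensions become isomorphic over `k̄`, both embed compatibly in an algebraic
closure of `k̄(x)`, where one radical generates an extension containing the other; hence the
radicands agree up to cubes and inversion. -/
theorem cube_classes_of_geomIsomorphic (h3 : (3 : k) ≠ 0)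
    (h : GeomIsomorphic k (RatFunc k) L₁ L₂)
    (hdeg₂ : Module.finrank (RatFunc k) L₂ = 3) {y₁ : L₁} {y₂ : L₂}
    (hgen₂ : (RatFunc k)⟮y₂⟯ = ⊤) {D₁ D₂ : RatFunc k}
    (hy₁ : y₁ ^ 3 = algebraMap (RatFunc k) L₁ D₁) (hy₂ : y₂ ^ 3 = algebraMap (RatFunc k) L₂ D₂)
    (hD₂ : ∀ b, b ^ 3 ≠ geomMap k D₂) :
    ∃ b, geomMap k D₁ = b ^ 3 ∨ geomMap k D₁ = b ^ 3 * geomMap k D₂ ∨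
      geomMap k D₁ = b ^ 3 * geomMap k D₂ ^ 2 := by
  obtain ⟨φ, hφ⟩ := h
  have := FiniteDimensional.of_finrank_eq_succ hdeg₂
  let M := RatFunc (AlgebraicClosure k)
  let F := AlgebraicClosure M
  let τ : RatFunc k →+* F := (algebraMap M F).comp (geomMap k)
  have hτk : ∀ c : k, τ (algebraMap k (RatFunc k) c) = algebraMap k F c := by
    intro c
    change algebraMap M F (geomMap k _) = _
    rw [RatFunc.algebraMap_eq_C, geomMap_C, IsScalarTower.algebraMap_apply k (AlgebraicClosure k) F,
      IsScalarTower.algebraMap_apply (AlgebraicClosure k) M F, RatFunc.algebraMap_eq_C]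
  obtain ⟨σ, hσ⟩ : ∃ σ : L₂ →+* F, ∀ a, σ (algebraMap (RatFunc k) L₂ a) = τ a := by
    let := τ.toAlgebra
    exact ⟨(IsAlgClosed.lift (R := RatFunc k) (S := L₂) (M := F)).toRingHom,
      fun a => AlgHom.commutes _ a⟩
  let σ' : L₂ →ₐ[k] F :=
    { σ with
      commutes' := fun c => by
        change σ (algebraMap k L₂ c) = _
        rw [IsScalarTower.algebraMap_apply k (RatFunc k) L₂, hσ, hτk] }
  let Θ : AlgebraicClosure k ⊗[k] L₂ →ₐ[AlgebraicClosure k] F :=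
    Algebra.TensorProduct.lift (Algebra.ofId _ _) σ' fun _ _ => Commute.all _ _
  have hΘ : ∀ a l, Θ (a ⊗ₜ l) = algebraMap M F (algebraMap _ M a) * σ l := fun a l => by
    change Algebra.TensorProduct.lift _ _ _ _ = _
    rw [Algebra.TensorProduct.lift_tmul, Algebra.ofId_apply,
      IsScalarTower.algebraMap_apply (AlgebraicClosure k) M F]
    rfl
  have hΘ1 : ∀ l, Θ (1 ⊗ₜ l) = σ l := fun l => by rw [hΘ, map_one, map_one, one_mul]
  have hz : (σ y₂) ^ 3 = algebraMap M F (geomMap k D₂) := by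
    rw [← map_pow, hy₂, hσ]
    rfl
  have hmem : ∀ w, Θ w ∈ Algebra.adjoin M {σ y₂} := by
    intro w
    induction w using TensorProduct.induction_on with
    | zero => rw [map_zero]; exact zero_mem _
    | add a b ha hb => rw [map_add]; exact add_mem ha hb
    | tmul a l =>
      rw [hΘ]
      refine mul_mem (Subalgebra.algebraMap_mem _ _) ?_
      obtain ⟨q, rfl⟩ := exists_aeval_eq_of_adjoin_eq_top hgen₂ l
      have h1 : σ (Polynomial.aeval y₂ q) = Polynomial.aeval (σ y₂) (q.map (geomMap k)) := by
        rw [Polynomial.aeval_def, Polynomial.hom_eval₂, Polynomial.aeval_def, Polynomial.eval₂_map]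
        congr 1
        ext a
        exact hσ a
      rw [h1]
      exact Polynomial.aeval_mem_adjoin_singleton _ _
  have h3' : (3 : M) ≠ 0 := by
    have h4 : (3 : RatFunc k) ≠ 0 := by
      rw [← map_ofNat RatFunc.C 3]
      exact ratFuncC_ne_zero h3
    rw [← map_ofNat (geomMap k) 3]
    simpa only [ne_eq, map_eq_zero] using h4
  refine cube_classes_of_mem_adjoin h3' hz (w := Θ (φ (1 ⊗ₜ y₁))) ?_ (hmem _) hD₂
  rw [← map_pow, ← map_pow, Algebra.TensorProduct.tmul_pow, one_pow, hy₁, hφ, hΘ1, hσ]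
  rfl

variable {P : ℕ → {p : k[X] // p.Monic ∧ Irreducible p}} {s r n : ℕ}
  {S : Set (Place k (RatFunc k))}

/-- Since `k` is perfect, a root of `P j` in `k̄` is simple, and it is no root of the other
`P i`. -/
lemma exists_ordAt_geomMap_primeProd [PerfectField k] (hinj : Set.InjOn P (Set.Icc 1 n)) {j : ℕ}
    (hj : j ∈ Finset.Icc 1 n) :
    ∃ (Q : (AlgebraicClosure k)[X]) (hQ : Irreducible Q), ∀ (u : k) (_ : u ≠ 0) (e : ℕ → ℤ),
      ordAt Q hQ (geomMap k (RatFunc.C u * primeProd P n e)) = e j := by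
  obtain ⟨α, hα⟩ := IsAlgClosed.exists_aeval_eq_zero (AlgebraicClosure k) (P j).1
    (Polynomial.degree_pos_of_irreducible (P j).2.2).ne'
  have hQ := Polynomial.irreducible_X_sub_C α
  refine ⟨_, hQ, fun u hu e => ?_⟩
  have hself : ordAt _ hQ (geomMap k (algebraMap k[X] (RatFunc k) (P j).1)) = 1 := by
    have hdvd : Polynomial.X - Polynomial.C α ∣
        (P j).1.map (algebraMap k (AlgebraicClosure k)) := by
      rw [Polynomial.dvd_iff_isRoot, Polynomial.IsRoot, Polynomial.eval_map_algebraMap, hα]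
    obtain ⟨g, hg⟩ := hdvd
    have hgα : ¬ Polynomial.X - Polynomial.C α ∣ g := by
      rw [Polynomial.dvd_iff_isRoot, Polynomial.IsRoot]
      intro h0
      have hsep := (PerfectField.separable_of_irreducible (P j).2.2).aeval_derivative_ne_zero hα
      rw [← Polynomial.eval_map_algebraMap, ← Polynomial.derivative_map, hg] at hsep
      simp [h0] at hsep
    have hg0 : g ≠ 0 := fun h => hgα (h ▸ dvd_zero _)
    rw [geomMap_algebraMap, hg, map_mul, ordAt_mul hQ (algebraMap_poly_ne_zero hQ.ne_zero)
      (algebraMap_poly_ne_zero hg0), ordAt_self, ordAt_of_not_dvd hQ hgα, add_zero]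
  have hother : ∀ i ∈ Finset.Icc 1 n, i ≠ j →
      ordAt _ hQ (geomMap k (algebraMap k[X] (RatFunc k) (P i).1)) = 0 := by
    intro i hi hij
    rw [geomMap_algebraMap]
    refine ordAt_of_not_dvd hQ ?_
    rw [Polynomial.dvd_iff_isRoot, Polynomial.IsRoot, Polynomial.eval_map_algebraMap]
    intro h0
    have hd : (P i).1 = (P j).1 :=
      (minpoly.eq_of_irreducible_of_monic (P i).2.2 h0 (P i).2.1).trans
        (minpoly.eq_of_irreducible_of_monic (P j).2.2 hα (P j).2.1).symm
    exact hij (hinj (by simpa using hi) (by simpa using hj) (Subtype.ext hd))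
  have hne : ∀ i, geomMap k (algebraMap k[X] (RatFunc k) (P i).1) ≠ 0 := fun i => by
    simpa only [ne_eq, map_eq_zero] using algebraMap_poly_ne_zero (P i).2.2.ne_zero
  have hu' : algebraMap k (AlgebraicClosure k) u ≠ 0 := by simpa using hu
  rw [primeProd, map_mul, map_prod, geomMap_C]
  simp only [map_zpow₀]
  rw [ordAt_mul hQ (ratFuncC_ne_zero hu')
      (Finset.prod_ne_zero_iff.mpr fun i _ => zpow_ne_zero _ (hne i)), ordAt_C hQ hu',
    ordAt_prod hQ _ _ fun i _ => zpow_ne_zero _ (hne i), zero_add,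
    Finset.sum_eq_single_of_mem j hj, ordAt_zpow, hself, mul_one]
  intro i hi hij
  rw [ordAt_zpow, hother i hi hij, mul_zero]

/-- The signs are an invariant of the extension over `k̄`. -/
theorem IsIndexing.eq_of_geomIsomorphic [PerfectField k] (h3 : (3 : k) ≠ 0)
    (hI : IsIndexing P s r n S) (hn : 1 ≤ n) (h : GeomIsomorphic k (RatFunc k) L₁ L₂)
    (hdeg₂ : Module.finrank (RatFunc k) L₂ = 3) {y₁ : L₁} {y₂ : L₂}
    (hgen₂ : (RatFunc k)⟮y₂⟯ = ⊤) {u₁ u₂ : k} (hu₁ : u₁ ≠ 0) (hu₂ : u₂ ≠ 0) {ε₁ ε₂ : ℕ → ℤ}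
    (hε₁ : ∀ i ∈ Finset.Icc 1 n, ε₁ i = 1 ∨ ε₁ i = -1)
    (hε₂ : ∀ i ∈ Finset.Icc 1 n, ε₂ i = 1 ∨ ε₂ i = -1) (h₁ : ε₁ 1 = 1) (h₂ : ε₂ 1 = 1)
    (hy₁ : y₁ ^ 3 = algebraMap (RatFunc k) L₁ (radicand P s r n u₁ ε₁))
    (hy₂ : y₂ ^ 3 = algebraMap (RatFunc k) L₂ (radicand P s r n u₂ ε₂)) :
    ∀ i ∈ Finset.Icc 1 n, ε₁ i = ε₂ i := by
  have hm : 1 ∈ Finset.Icc 1 n := by simp [hn]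
  rw [radicand_eq P hI.le_r hI.le_n] at hy₁ hy₂
  obtain ⟨Q₁, hQ₁, hord₁⟩ := exists_ordAt_geomMap_primeProd hI.injOn hm
  have hD : ∀ b, b ^ 3 ≠
      geomMap k (RatFunc.C u₂ * primeProd P n fun i => orient s r i * ε₂ i) := by
    intro b hb
    have h1 := congrArg (ordAt Q₁ hQ₁) hb
    rw [hord₁ _ hu₂, ordAt_pow, h₂] at h1
    rcases orient_eq_or s r 1 with h4 | h4 <;> rw [h4] at h1 <;> omega
  have hne : ∀ (u : k) (e : ℕ → ℤ), u ≠ 0 → geomMap k (RatFunc.C u * primeProd P n e) ≠ 0 :=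
    fun u e hu => by
      rw [ne_eq, map_eq_zero]
      exact mul_ne_zero (ratFuncC_ne_zero hu) (primeProd_ne_zero P n e)
  have hE := hne u₁ (fun i => orient s r i * ε₁ i) hu₁
  have hD0 := hne u₂ (fun i => orient s r i * ε₂ i) hu₂
  obtain ⟨b, hb | hb | hb⟩ := cube_classes_of_geomIsomorphic h3 h hdeg₂ hgen₂ hy₁ hy₂ hD
  · exfalso
    have h1 := congrArg (ordAt Q₁ hQ₁) hb
    rw [hord₁ _ hu₁, ordAt_pow, h₁] at h1
    rcases orient_eq_or s r 1 with h4 | h4 <;> rw [h4] at h1 <;> omega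
  · intro i hi
    obtain ⟨Q, hQ, hord⟩ := exists_ordAt_geomMap_primeProd hI.injOn hi
    have hb0 : b ^ 3 ≠ 0 := fun h0 => hE (by rw [hb, h0, zero_mul])
    have h1 := congrArg (ordAt Q hQ) hb
    rw [ordAt_mul hQ hb0 hD0, hord _ hu₁, hord _ hu₂, ordAt_pow] at h1
    rcases orient_eq_or s r i with h4 | h4 <;> rcases hε₁ i hi with h5 | h5 <;>
      rcases hε₂ i hi with h6 | h6 <;> rw [h4, h5, h6] at h1 <;> rw [h5, h6] <;> omega
  · exfalso
    have hb0 : b ^ 3 ≠ 0 := fun h0 => hE (by rw [hb, h0, zero_mul])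
    have h1 := congrArg (ordAt Q₁ hQ₁) hb
    rw [ordAt_mul hQ₁ hb0 (pow_ne_zero _ hD0), ordAt_pow, ordAt_pow, hord₁ _ hu₁, hord₁ _ hu₂,
      h₁, h₂] at h1
    rcases orient_eq_or s r 1 with h4 | h4 <;> rw [h4] at h1 <;> omega

end Geometric

/-! ### Counting signs -/

section Count

/-- The sign vector that is `-1` exactly on `A`. -/
def signs (A : Finset ℕ) (i : ℕ) : ℤ := if i ∈ A then -1 else 1

lemma signs_eq_or (A : Finset ℕ) (i : ℕ) : signs A i = 1 ∨ signs A i = -1 := by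
  unfold signs; split_ifs <;> simp

lemma signs_of_notMem {A : Finset ℕ} {i : ℕ} (h : i ∉ A) : signs A i = 1 := if_neg h

/-- The number of sign vectors on `J` whose sum over the indices greater than `s` is `-c` modulo
three. The recursion on `J` is `N(J ∪ {j}, c) = N(J, c + 1) + N(J, c - 1)` for `j > s`. -/
lemma three_mul_card_signs (s : ℕ) (J : Finset ℕ) (c : ℤ) :
    3 * ((J.powerset.filter fun A => c + ∑ i ∈ J with s < i, signs A i ≡ 0 [ZMOD 3]).card : ℤ) =
      2 ^ (J.filter fun i => ¬ s < i).card * (2 ^ (J.filter fun i => s < i).card +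
        (if c ≡ 0 [ZMOD 3] then 2 else -1) * (-1) ^ (J.filter fun i => s < i).card) := by
  induction J using Finset.induction_on generalizing c with
  | empty => by_cases h : c ≡ 0 [ZMOD 3] <;> simp [h]
  | insert j J hj ih =>
    have hsum₁ : ∀ A ∈ J.powerset, ∑ i ∈ J with s < i, signs (insert j A) i =
        ∑ i ∈ J with s < i, signs A i := by
      intro A _
      refine Finset.sum_congr rfl fun i hi => ?_
      have : i ≠ j := by rintro rfl; exact hj (Finset.mem_filter.mp hi).1
      simp [signs, this]
    have hrec : ∀ d : ℤ, (∀ A ∈ J.powerset, ∑ i ∈ insert j J with s < i, signs A i =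
          d + ∑ i ∈ J with s < i, signs A i) →
        (∀ A ∈ J.powerset, ∑ i ∈ insert j J with s < i, signs (insert j A) i =
          -d + ∑ i ∈ J with s < i, signs A i) →
        (((insert j J).powerset.filter
          fun A => c + ∑ i ∈ insert j J with s < i, signs A i ≡ 0 [ZMOD 3]).card : ℤ) =
        ((J.powerset.filter
          fun A => (c + d) + ∑ i ∈ J with s < i, signs A i ≡ 0 [ZMOD 3]).card : ℤ) +
        ((J.powerset.filter
          fun A => (c - d) + ∑ i ∈ J with s < i, signs A i ≡ 0 [ZMOD 3]).card : ℤ) := by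
      intro d h₁ h₂
      rw [Finset.card_filter, Finset.card_filter, Finset.card_filter, Finset.sum_powerset_insert hj]
      push_cast
      congr 1
      · exact Finset.sum_congr rfl fun A hA => by rw [h₁ A hA, ← add_assoc]
      · exact Finset.sum_congr rfl fun A hA => by rw [h₂ A hA, ← add_assoc, ← sub_eq_add_neg]
    by_cases hsj : s < j
    · have hj' : j ∉ J.filter fun i => s < i := fun h => hj (Finset.mem_filter.mp h).1
      have h1 := hrec 1 (fun A hA => by
          rw [Finset.filter_insert, if_pos hsj, Finset.sum_insert hj',
            signs_of_notMem fun h => hj (Finset.mem_powerset.mp hA h)])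
        (fun A hA => by
          rw [Finset.filter_insert, if_pos hsj, Finset.sum_insert hj', hsum₁ A hA]
          simp [signs])
      rw [h1, mul_add, ih, ih, Finset.filter_insert, if_neg (not_not.mpr hsj),
        Finset.filter_insert, if_pos hsj, Finset.card_insert_of_notMem hj']
      rcases (by omega : c % 3 = 0 ∨ c % 3 = 1 ∨ c % 3 = 2) with h | h | h
      · rw [if_neg (by simp only [Int.ModEq]; omega), if_neg (by simp only [Int.ModEq]; omega),
          if_pos (by simp only [Int.ModEq]; omega)]
        ring
      · rw [if_neg (by simp only [Int.ModEq]; omega), if_pos (by simp only [Int.ModEq]; omega),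
          if_neg (by simp only [Int.ModEq]; omega)]
        ring
      · rw [if_pos (by simp only [Int.ModEq]; omega), if_neg (by simp only [Int.ModEq]; omega),
          if_neg (by simp only [Int.ModEq]; omega)]
        ring
    · have hj' : j ∉ J.filter fun i => ¬ s < i := fun h => hj (Finset.mem_filter.mp h).1
      have h1 := hrec 0 (fun A hA => by rw [Finset.filter_insert, if_neg hsj, zero_add])
        (fun A hA => by rw [Finset.filter_insert, if_neg hsj, hsum₁ A hA, neg_zero, zero_add])
      rw [h1, add_zero, sub_zero, mul_add, ih, Finset.filter_insert, if_pos hsj,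
        Finset.filter_insert, if_neg hsj, Finset.card_insert_of_notMem hj']
      ring

/-- The normalized sign vectors on `1, …, n` (the first sign is `1`), given by the set of their
negative entries, whose sum over `s + 1, …, n` is divisible by three (for `b` true),
respectively not divisible by three (for `b` false). -/
def normalizedSigns (s n : ℕ) (b : Prop) [Decidable b] : Finset (Finset ℕ) :=
  (Finset.Icc 2 n).powerset.filter fun A =>
    b ↔ ∑ i ∈ Finset.Icc (s + 1) n, signs A i ≡ 0 [ZMOD 3]

lemma normalizedSigns_congr (s n : ℕ) {b b' : Prop} [Decidable b] [Decidable b'] (h : b ↔ b') :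
    normalizedSigns s n b = normalizedSigns s n b' :=
  Finset.filter_congr fun _ _ => by rw [h]

lemma three_mul_card_normalizedSigns_true {s n : ℕ} (hn : 1 ≤ n) :
    3 * ((normalizedSigns s n True).card : ℤ) =
      2 ^ ((Finset.Icc 2 n).filter fun i => ¬ s < i).card *
        (2 ^ ((Finset.Icc 2 n).filter fun i => s < i).card +
          (if s = 0 then -1 else 2) * (-1) ^ ((Finset.Icc 2 n).filter fun i => s < i).card) := by
  have h := three_mul_card_signs s (Finset.Icc 2 n) (if s = 0 then 1 else 0)
  have hc : (if (if s = 0 then (1 : ℤ) else 0) ≡ 0 [ZMOD 3] then (2 : ℤ) else -1) =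
      if s = 0 then -1 else 2 := by
    by_cases hs : s = 0
    · rw [if_pos hs, if_pos hs, if_neg (by decide)]
    · rw [if_neg hs, if_neg hs, if_pos (Int.ModEq.refl 0)]
  rw [hc] at h
  rw [← h, normalizedSigns]
  congr 3
  refine Finset.filter_congr fun A hA => ?_
  have h1 : 1 ∉ A := fun h => by
    have := Finset.mem_Icc.mp (Finset.mem_powerset.mp hA h)
    omega
  have hsum : ∑ i ∈ Finset.Icc (s + 1) n, signs A i =
      (if s = 0 then 1 else 0) + ∑ i ∈ Finset.Icc 2 n with s < i, signs A i := by
    by_cases hs : s = 0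
    · have h2 : Finset.Icc (s + 1) n = insert 1 ((Finset.Icc 2 n).filter fun i => s < i) := by
        ext i; simp only [Finset.mem_Icc, Finset.mem_insert, Finset.mem_filter]; omega
      rw [h2, Finset.sum_insert (by simp), signs_of_notMem h1, if_pos hs]
    · have h2 : Finset.Icc (s + 1) n = (Finset.Icc 2 n).filter fun i => s < i := by
        ext i; simp only [Finset.mem_Icc, Finset.mem_filter]; omega
      rw [h2, if_neg hs, zero_add]
  rw [hsum, true_iff]

lemma card_filter_lt (s n : ℕ) :
    ((Finset.Icc 2 n).filter fun i => s < i).card = n + 1 - max 2 (s + 1) := by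
  have : ((Finset.Icc 2 n).filter fun i => s < i) = Finset.Icc (max 2 (s + 1)) n := by
    ext i; simp only [Finset.mem_Icc, Finset.mem_filter]; omega
  rw [this, Nat.card_Icc]

lemma card_filter_not_lt {s n : ℕ} (hs : s ≤ n) :
    ((Finset.Icc 2 n).filter fun i => ¬ s < i).card = s - 1 := by
  have : ((Finset.Icc 2 n).filter fun i => ¬ s < i) = Finset.Icc 2 s := by
    ext i; simp only [Finset.mem_Icc, Finset.mem_filter]; omega
  rw [this, Nat.card_Icc]
  omega

lemma card_normalizedSigns_true {s n : ℕ} (hs : s ≤ n) (hn : 1 ≤ n) :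
    ((normalizedSigns s n True).card : ℚ) =
      (1 / 3) * 2 ^ s * (2 ^ ((n : ℤ) - s - 1) - (-1) ^ ((n : ℤ) - s - 1)) := by
  have h := three_mul_card_normalizedSigns_true (s := s) hn
  rw [card_filter_lt, card_filter_not_lt hs] at h
  have h' : 3 * ((normalizedSigns s n True).card : ℚ) =
      2 ^ (s - 1) * (2 ^ (n + 1 - max 2 (s + 1)) +
          (if s = 0 then -1 else 2) * (-1) ^ (n + 1 - max 2 (s + 1))) := by
    exact_mod_cast h
  rcases Nat.eq_zero_or_pos s with rfl | hs0
  · obtain ⟨m, rfl⟩ := Nat.exists_eq_add_of_le hn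
    rw [if_pos rfl, show 1 + m + 1 - max 2 (0 + 1) = m by omega] at h'
    rw [show ((1 + m : ℕ) : ℤ) - (0 : ℕ) - 1 = m by push_cast; ring, zpow_natCast, zpow_natCast]
    linear_combination (1 / 3) * h'
  · obtain ⟨l, rfl⟩ := Nat.exists_eq_add_of_le hs0
    obtain ⟨m, rfl⟩ := Nat.exists_eq_add_of_le hs
    rw [if_neg (by omega), show 0 + 1 + l + m + 1 - max 2 (0 + 1 + l + 1) = m by omega,
      show 0 + 1 + l - 1 = l by omega] at h'
    rw [show ((0 + 1 + l + m : ℕ) : ℤ) - (0 + 1 + l : ℕ) - 1 = (m : ℤ) - 1 by push_cast; ring,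
      zpow_sub_one₀ (by norm_num), zpow_sub_one₀ (by norm_num), zpow_natCast, zpow_natCast, pow_add]
    linear_combination (1 / 3) * h'

lemma card_normalizedSigns_false {s n : ℕ} (hs : s ≤ n) (hn : 1 ≤ n) :
    ((normalizedSigns s n False).card : ℚ) =
      (1 / 3) * 2 ^ s * (2 ^ (n - s) - (-1) ^ (n - s)) := by
  have h := card_normalizedSigns_true hs hn
  have hadd : (normalizedSigns s n True).card + (normalizedSigns s n False).card = 2 ^ (n - 1) := by
    simp only [normalizedSigns, true_iff, false_iff]
    rw [Finset.card_filter_add_card_filter_not, Finset.card_powerset, Nat.card_Icc]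
    congr 1
  have hadd' : ((normalizedSigns s n True).card : ℚ) + (normalizedSigns s n False).card
      = 2 ^ (n - 1) := by exact_mod_cast hadd
  obtain ⟨m, rfl⟩ := Nat.exists_eq_add_of_le hs
  rw [show ((s + m : ℕ) : ℤ) - s - 1 = (m : ℤ) - 1 by push_cast; ring,
    zpow_sub_one₀ (by norm_num), zpow_sub_one₀ (by norm_num), zpow_natCast, zpow_natCast] at h
  have h2 : (2 : ℚ) ^ (s + m - 1) * 2 = 2 ^ s * 2 ^ m := by
    rw [← pow_succ, Nat.sub_add_cancel hn, pow_add]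
  rw [Nat.add_sub_cancel_left]
  linear_combination hadd' - h + (1 / 2) * h2

end Count

/-! ### Classification of covers -/

section Classification

lemma IsPurelyCubic.exists_generator {k K L : Type*} [Field k] [Field K] [Field L] [Algebra k K]
    [Algebra k L] [Algebra K L] [IsScalarTower k K L] (h : IsPurelyCubic k K L) :
    ∃ (y : L) (β : K), K⟮y⟯ = ⊤ ∧ β ≠ 0 ∧ y ^ 3 = algebraMap K L β := by
  obtain ⟨hc, y, β, hgen, hmin⟩ := h
  have hy : y ^ 3 = algebraMap K L β := by
    have h1 := minpoly.aeval K y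
    rw [hmin] at h1
    simpa [sub_eq_zero] using h1
  refine ⟨y, β, hgen, ?_, hy⟩
  rintro rfl
  rw [map_zero] at hy
  have hy0 : y = 0 := by simpa using hy
  have hdeg := hc.degree
  rw [← IntermediateField.finrank_top', ← hgen, hy0, IntermediateField.adjoin_zero,
    IntermediateField.finrank_bot] at hdeg
  omega

variable {k : Type u} [Field k] {P : ℕ → {p : k[X] // p.Monic ∧ Irreducible p}} {s r n : ℕ}
  {T : Set (Place k (RatFunc k))}

/-- The equation of a purely cubic extension with prescribed fully ramified places. -/
theorem IsIndexing.exists_equation (h3 : (3 : k) ≠ 0)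
    (h : IsIndexing P s r n (T \ {inftyPlace k})) {L : Type v} [Field L] [Algebra k L]
    [Algebra (RatFunc k) L] [IsScalarTower k (RatFunc k) L] (hL : IsPurelyCubic k (RatFunc k) L)
    (hram : fullyRamifiedPlaces k (RatFunc k) L = T) :
    ∃ (y : L) (u : k) (ε : ℕ → ℤ), (RatFunc k)⟮y⟯ = ⊤ ∧ u ≠ 0 ∧ ε 1 = 1 ∧
      (∀ i ∈ Finset.Icc 1 n, ε i = 1 ∨ ε i = -1) ∧
      (inftyPlace k ∉ T ↔ ∑ i ∈ Finset.Icc (s + 1) n, ε i ≡ 0 [ZMOD 3]) ∧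
      y ^ 3 = algebraMap (RatFunc k) L (radicand P s r n u ε) := by
  obtain ⟨y₀, β, hgen₀, hβ, hy₀⟩ := hL.exists_generator
  obtain ⟨y, u, ε, hgen, hu, h1, hε, hy⟩ :=
    h.exists_generator h3 hL.1.degree hgen₀ hβ hy₀ (by rw [hram])
  refine ⟨y, u, ε, hgen, hu, h1, hε, ?_, hy⟩
  have h2 := h.mem_fullyRamifiedPlaces_iff h3 hL.1.degree hgen hu hε hy (inftyPlace k)
  rw [hram] at h2
  rw [h2]
  simp

/-- The covers up to isomorphism over `k̄` correspond to the normalized sign vectors. -/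
theorem IsIndexing.exists_coverClass_equiv [PerfectField k] [Decidable (inftyPlace k ∉ T)]
    (h3 : (3 : k) ≠ 0) (h : IsIndexing P s r n (T \ {inftyPlace k})) (hn : 1 ≤ n) :
    Nonempty (CoverClass k T ≃ normalizedSigns s n (inftyPlace k ∉ T)) := by
  have hcongr : ∀ (u : k) (ε ε' : ℕ → ℤ), (∀ i ∈ Finset.Icc 1 n, ε i = ε' i) →
      radicand P s r n u ε = radicand P s r n u ε' := fun u ε ε' he => by
    rw [radicand_eq P h.le_r h.le_n, radicand_eq P h.le_r h.le_n]
    congr 1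
    exact primeProd_congr P fun i hi => by rw [he i hi]
  have hsplit : ∀ (u : k) (ε : ℕ → ℤ), radicand P s r n u ε =
      algebraMap k (RatFunc k) u * radicand P s r n 1 ε := fun u ε => by
    rw [radicand_eq P h.le_r h.le_n, radicand_eq P h.le_r h.le_n, RatFunc.algebraMap_eq_C, map_one,
      one_mul]
  -- an equation for each cover
  have hex : ∀ C : Cover k T, ∃ A ∈ normalizedSigns s n (inftyPlace k ∉ T),
      ∃ (y : C.carrier) (u : k), (RatFunc k)⟮y⟯ = ⊤ ∧ u ≠ 0 ∧
        y ^ 3 = algebraMap (RatFunc k) C.carrier (radicand P s r n u (signs A)) := by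
    intro C
    obtain ⟨y, u, ε, hgen, hu, h1, hε, hT, hy⟩ := h.exists_equation h3 C.purelyCubic C.ramified
    have hA : ∀ i ∈ Finset.Icc 1 n,
        ε i = signs ((Finset.Icc 2 n).filter fun i => ε i = -1) i := by
      intro i hi
      rw [Finset.mem_Icc] at hi
      rcases hε i (Finset.mem_Icc.mpr hi) with h2 | h2
      · rw [signs_of_notMem (by simp [h2]), h2]
      · have : i ≠ 1 := by rintro rfl; omega
        rw [signs, if_pos (by simp only [Finset.mem_filter, Finset.mem_Icc]; omega), h2]
    refine ⟨(Finset.Icc 2 n).filter fun i => ε i = -1, ?_, y, u, hgen, hu, ?_⟩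
    · rw [normalizedSigns, Finset.mem_filter, Finset.mem_powerset]
      refine ⟨Finset.filter_subset _ _, hT.trans ?_⟩
      rw [Finset.sum_congr rfl fun i hi => hA i (by
        rw [Finset.mem_Icc] at hi ⊢; omega)]
    · rw [hy, hcongr u _ _ hA]
  choose A hA y u hgen hu hy using hex
  have hone : ∀ B ∈ normalizedSigns s n (inftyPlace k ∉ T), signs B 1 = 1 := fun B hB =>
    signs_of_notMem fun h1 => by
      have := Finset.mem_Icc.mp (Finset.mem_powerset.mp (Finset.mem_filter.mp hB).1 h1)
      omega
  have hinj : ∀ B ∈ normalizedSigns s n (inftyPlace k ∉ T),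
      ∀ B' ∈ normalizedSigns s n (inftyPlace k ∉ T),
      (∀ i ∈ Finset.Icc 1 n, signs B i = signs B' i) → B = B' := by
    intro B hB B' hB' hs
    have hsub : ∀ B ∈ normalizedSigns s n (inftyPlace k ∉ T), ∀ i ∈ B, i ∈ Finset.Icc 1 n :=
      fun B hB i hi => by
        have := Finset.mem_Icc.mp (Finset.mem_powerset.mp (Finset.mem_filter.mp hB).1 hi)
        rw [Finset.mem_Icc]; omega
    ext i
    constructor
    · intro hi
      have := hs i (hsub B hB i hi)
      by_contra hi'
      rw [signs, if_pos hi, signs_of_notMem hi'] at this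
      omega
    · intro hi
      have := hs i (hsub B' hB' i hi)
      by_contra hi'
      rw [signs_of_notMem hi', signs, if_pos hi] at this
      omega
  have hinv : ∀ C C' : Cover k T, GeomIsomorphic k (RatFunc k) C.carrier C'.carrier →
      ∀ B ∈ normalizedSigns s n (inftyPlace k ∉ T), ∀ (y' : C'.carrier) (u' : k), u' ≠ 0 →
        (RatFunc k)⟮y'⟯ = ⊤ →
        y' ^ 3 = algebraMap (RatFunc k) C'.carrier (radicand P s r n u' (signs B)) → A C = B := by
    intro C C' hCC B hB y' u' hu' hgen' hy'
    exact hinj _ (hA C) _ hB (h.eq_of_geomIsomorphic h3 hn hCC C'.purelyCubic.1.degree hgen' (hu C)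
      hu' (fun i _ => signs_eq_or _ i) (fun i _ => signs_eq_or _ i) (hone _ (hA C)) (hone _ hB)
      (hy C) hy')
  refine ⟨Equiv.ofBijective (Quotient.lift
    (fun C => (⟨A C, hA C⟩ : normalizedSigns s n (inftyPlace k ∉ T))) fun C C' hCC =>
      Subtype.ext (hinv C C' hCC _ (hA C') _ _ (hu C') (hgen C') (hy C'))) ⟨?_, ?_⟩⟩
  · intro c c'
    induction c using Quotient.inductionOn with | _ C
    induction c' using Quotient.inductionOn with | _ C'
    intro hCC
    have hCC' : A C = A C' := congrArg Subtype.val hCC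
    refine Quotient.sound ?_
    have hy1 := hy C
    have hy2 := hy C'
    rw [hsplit] at hy1 hy2
    rw [← hCC'] at hy2
    exact geomIsomorphic_of_pow_three C.purelyCubic.1.degree C'.purelyCubic.1.degree (hgen C)
      (hgen C') (hu C) (hu C') hy1 hy2
  · rintro ⟨B, hB⟩
    obtain ⟨C, y', hgen', hy'⟩ := h.exists_cover h3 hn (ε := signs B) (fun i _ => signs_eq_or _ i)
      (not_iff_comm.mp (Finset.mem_filter.mp hB).2 |>.symm)
    refine ⟨Quotient.mk _ C, Subtype.ext ?_⟩
    exact hinv C C ⟨AlgEquiv.refl, fun _ => rfl⟩ B hB y' 1 one_ne_zero hgen' hy'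

end Classification

end PurelyCubic

end

theorem mainTheorem4 {k : Type u} [Field k] [PerfectField k] (hchar : (3 : k) ≠ 0)
    (T : Finset (PurelyCubic.Place k (RatFunc k))) (t : ℕ) (hT : T.card = t) :
    (PurelyCubic.inftyPlace k ∉ T →
      ∀ (s r : ℕ) (P : ℕ → {p : Polynomial k // p.Monic ∧ Irreducible p}),
        PurelyCubic.IsIndexing P s r t (T : Set (PurelyCubic.Place k (RatFunc k))) →
        (∀ (L : Type v) [Field L] [Algebra k L] [Algebra (RatFunc k) L]
            [IsScalarTower k (RatFunc k) L],
          PurelyCubic.IsPurelyCubic k (RatFunc k) L →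
          PurelyCubic.fullyRamifiedPlaces k (RatFunc k) L = T →
          ∃ (y : L) (u : k) (ε : ℕ → ℤ),
            IntermediateField.adjoin (RatFunc k) {y} = ⊤ ∧
            u ≠ 0 ∧ ε 1 = 1 ∧ (∀ i ∈ Finset.Icc 1 t, ε i = 1 ∨ ε i = -1) ∧
            ∑ i ∈ Finset.Icc (s + 1) t, ε i ≡ 0 [ZMOD 3] ∧
            y ^ 3 = algebraMap (RatFunc k) L (PurelyCubic.radicand P s r t u ε)) ∧
        (T.Nonempty →
          Finite (PurelyCubic.CoverClass k (T : Set (PurelyCubic.Place k (RatFunc k)))) ∧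
          (Nat.card (PurelyCubic.CoverClass k (T : Set (PurelyCubic.Place k (RatFunc k)))) : ℚ) =
            (1 / 3) * 2 ^ s * (2 ^ ((t : ℤ) - s - 1) - (-1) ^ ((t : ℤ) - s - 1)))) ∧
    (PurelyCubic.inftyPlace k ∈ T →
      ∀ (s r : ℕ) (P : ℕ → {p : Polynomial k // p.Monic ∧ Irreducible p}),
        PurelyCubic.IsIndexing P s r (t - 1)
          ((T : Set (PurelyCubic.Place k (RatFunc k))) \ {PurelyCubic.inftyPlace k}) →
        (∀ (L : Type v) [Field L] [Algebra k L] [Algebra (RatFunc k) L]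
            [IsScalarTower k (RatFunc k) L],
          PurelyCubic.IsPurelyCubic k (RatFunc k) L →
          PurelyCubic.fullyRamifiedPlaces k (RatFunc k) L = T →
          ∃ (y : L) (u : k) (ε : ℕ → ℤ),
            IntermediateField.adjoin (RatFunc k) {y} = ⊤ ∧
            u ≠ 0 ∧ ε 1 = 1 ∧ (∀ i ∈ Finset.Icc 1 (t - 1), ε i = 1 ∨ ε i = -1) ∧
            ¬ (∑ i ∈ Finset.Icc (s + 1) (t - 1), ε i ≡ 0 [ZMOD 3]) ∧
            y ^ 3 = algebraMap (RatFunc k) L (PurelyCubic.radicand P s r (t - 1) u ε)) ∧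
        Finite (PurelyCubic.CoverClass k (T : Set (PurelyCubic.Place k (RatFunc k)))) ∧
        (Nat.card (PurelyCubic.CoverClass k (T : Set (PurelyCubic.Place k (RatFunc k)))) : ℚ) =
          (1 / 3) * 2 ^ s * (2 ^ ((t : ℤ) - s - 1) - (-1) ^ ((t : ℤ) - s - 1))) := by
  classical
  constructor
  · intro hinf s r P hI
    have hdiff : (T : Set (PurelyCubic.Place k (RatFunc k))) \ {PurelyCubic.inftyPlace k} = T :=
      Set.sdiff_singleton_eq_self (by simpa using hinf)
    rw [← hdiff] at hI
    refine ⟨fun L _ _ _ _ hL hram => ?_, fun hne => ?_⟩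
    · obtain ⟨y, u, ε, hgen, hu, h1, hε, hsum, hy⟩ := hI.exists_equation hchar hL hram
      exact ⟨y, u, ε, hgen, hu, h1, hε, hsum.mp (by simpa using hinf), hy⟩
    · have ht : 1 ≤ t := hT ▸ hne.card_pos
      obtain ⟨e⟩ := hI.exists_coverClass_equiv hchar ht
      refine ⟨Finite.of_equiv _ e.symm, ?_⟩
      rw [Nat.card_congr e, Nat.card_eq_fintype_card, Fintype.card_coe,
        PurelyCubic.normalizedSigns_congr s t (b' := True) (by simpa using hinf)]
      exact PurelyCubic.card_normalizedSigns_true (hI.le_r.trans hI.le_n) ht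
  · intro hinf s r P hI
    have ht : 1 ≤ t := hT ▸ (Finset.card_pos.mpr ⟨_, hinf⟩)
    obtain ⟨n, rfl⟩ : ∃ n, t = n + 1 := ⟨t - 1, by omega⟩
    rw [Nat.add_sub_cancel] at hI ⊢
    have hsn : s ≤ n := hI.le_r.trans hI.le_n
    refine ⟨fun L _ _ _ _ hL hram => ?_, ?_⟩
    · obtain ⟨y, u, ε, hgen, hu, h1, hε, hsum, hy⟩ := hI.exists_equation hchar hL hram
      exact ⟨y, u, ε, hgen, hu, h1, hε, fun h0 => hsum.mpr h0 (by simpa using hinf), hy⟩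
    have hexp : ((n + 1 : ℕ) : ℤ) - s - 1 = (n - s : ℕ) := by omega
    rw [hexp, zpow_natCast, zpow_natCast]
    rcases Nat.eq_zero_or_pos n with rfl | hn
    · -- without finite places in `T` the radicand is constant, so `∞` is not ramified either
      have : IsEmpty (PurelyCubic.CoverClass k (T : Set (PurelyCubic.Place k (RatFunc k)))) := by
        refine ⟨fun c => Quotient.inductionOn c fun C => ?_⟩
        obtain ⟨y, u, ε, -, -, -, -, hsum, -⟩ :=
          hI.exists_equation hchar C.purelyCubic C.ramified
        exact hsum.mpr (by simp) (by simpa using hinf)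
      refine ⟨inferInstance, ?_⟩
      obtain rfl : s = 0 := by omega
      simp
    · obtain ⟨e⟩ := hI.exists_coverClass_equiv hchar hn
      refine ⟨Finite.of_equiv _ e.symm, ?_⟩
      rw [Nat.card_congr e, Nat.card_eq_fintype_card, Fintype.card_coe,
        PurelyCubic.normalizedSigns_congr s n (b' := False) (by simpa using hinf)]
      exact PurelyCubic.card_normalizedSigns_false hsn hn
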